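/- **Theorem.** Let $\mathtt{server\_opt.s}$ be the CompCert x86-64 assembly module with two global definitions (under distinct names): a non-volatile read-only 32-bit constant $\mathtt{key}$ with initial value $42$, and a function $\mathtt{encrypt}$ of signature $\mathtt{int}\times\mathtt{ptr}\to\mathtt{void}$ with code $$\mathtt{Pallocframe\ 24\ 16\ 0;\ Pxori\ 42\ RDI;\ Pmov\ RDI\ 8(RSP);\ Plea\ 8(RSP)\ RDI;\ Pcall\ RSI;\ Pfreeframe\ 24\ 16\ 0;\ Pret}$$ (the value of $\mathtt{key}$ is inlined in the code), and let $[\![\mathtt{server\_opt.s}]\!]$ be its open semantics in CompCertO: a symbol-table-indexed labeled transition system (LTS) on register sets and memories, whose queries and replies are pairs $rs@m$ of a register set and a memory. Memories, values and injections ($j\vdash v\hookrightarrow v'$, $j\vdash m\hookrightarrow m'$) are those of CompCert's block-based memory model. Let $L_S$ be the C-level open LTS with the same global definitions and with internal states $\mathrm{Calle}\,i\,v_f\,m$, $\mathrm{Callp}\,sp\,v_f\,m$, $\mathrm{Retp}\,sp\,m$, $\mathrm{Rete}\,m$. C queries are $v_f[\mathit{sg}](\vec v)@m$ and C replies are $v@m$;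 $b_e$ and $b_k$ denote the blocks of $\mathtt{encrypt}$ and $\mathtt{key}$. It accepts the queries whose function pointer is $(b_e,0)$, and * the query $(b_e,0)[\mathtt{int}\times\mathtt{ptr}\to\mathtt{void}]([i,v_f])@m$ starts $\mathrm{Calle}\,i\,v_f\,m$; * $\mathrm{Calle}\,i\,v_f\,m\to\mathrm{Callp}\,sp\,v_f\,m''$, where $(m',sp)=\mathrm{alloc}\,m\,0\,8$ and $m''$ is $m'$ with the 32-bit integer $i\ \mathrm{XOR}\ m[b_k]$ stored at $(sp,0)$; * if $(b_p,0)$ points to a function external to the module, $\mathrm{Callp}\,sp\,(b_p,0)\,m$ issues the query $(b_p,0)[\mathtt{ptr}\to\mathtt{void}]([(sp,0)])@m$, and any reply $v@m'$ leads to $\mathrm{Retp}\,sp\,m'$; * $\mathrm{Retp}\,sp\,m\to\mathrm{Rete}\,m'$, where $m'$ is $m$ with cells $0$ to $7$ of $sp$ freed; * $\mathrm{Rete}\,m$ is final with reply $\mathrm{Vundef}@m$. A *simulation convention* $\mathbb{R}$ consists of a set of Kripke worlds and, for each world $w$, relations between source and target symbol tables, queries ($\mathbb{R}^q(w)$) and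 replies ($\mathbb{R}^r(w)$). Conventions are composed relationally: a world of $\mathbb{R}\cdot\mathbb{S}$ is a world of each together with an intermediate symbol table, and the symbol tables, queries and replies are related through it, through an intermediate query and through an intermediate reply. An *open simulation* $L_1\leqslant_{\mathbb{R}}L_2$ of modules with the same global definitions consists of relations $R$ between internal states, indexed by the world $w$ and the two symbol tables, such that, whenever the symbol tables are related at $w$ and provide the definitions of the module: (1) if two queries are related by $\mathbb{R}^q(w)$, then $L_1$ accepts the first iff $L_2$ accepts the second; (2) for queries related by $\mathbb{R}^q(w)$, every initial state of $L_1$ is related by $R$ to some initial state of $L_2$; (3) every internal step of $L_1$ from a related state is matched, preserving $R$, by finitely many (possibly zero) internal steps of $L_2$ with the same events; (4) if $L_1$ issues an outgoing query $q_1$ in a related state, then $L_2$ issues some $q_2$ there, and at some world $w'$ that relates the symbol tables $(q_1,q_2)\in\mathbb{R}^q(w')$, and for all replies related by $\mathbb{R}^r(w')$ every state in which $L_1$ resumes is related by $R$ to some state in which $L_2$ resumes; (5) if $L_1$ is final with reply $r_1$ in a related state, then $L_2$ is final with some reply $r_2$ such that $(r_1,r_2)\in\mathbb{R}^r(w)$.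 The *direct convention* is $\mathbb{C}=\mathit{ro}\cdot\mathit{wt}\cdot\mathit{CA}_{\mathit{injp}}\cdot\mathit{asm}_{\mathit{injp}}$, where: * Write $\mathrm{acc}(m,m')$ if valid blocks stay valid, maximal permissions of valid blocks do not increase, and every cell of $m$ that is not writable in $m$ (for maximal permissions) and is readable in $m'$ was readable in $m$ with the same value. Worlds of $\mathit{injp}$ are triples $(j,m_1,m_2)$; the memories related there are $m_1$ and $m_2$ themselves, provided that $j\vdash m_1\hookrightarrow m_2$; and $(j,m_1,m_2)\leadsto(j',m_1',m_2')$ iff $j\subseteq j'$, the cells of $m_1$ unmapped by $j$ and the cells of $m_2$ out of reach of $j$ from $m_1$ keep their permissions and values, $\mathrm{acc}(m_1,m_1')$, $\mathrm{acc}(m_2,m_2')$, and blocks mapped by $j'$ but not by $j$ are sent to new blocks and are new themselves. At a world of $\mathit{injp}$, symbol tables are related if they correspond under $j$ and their blocks are valid in $m_1$, $m_2$. * $\mathit{ro}$ (worlds $(se,m)$) relates equal queries with symbol table $se$ and memory $m$, if in $m$ all blocks of $se$ are valid and every constant global variable (read-only, non-volatile, with a definitive initializer) is not writable and has its initial value in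 all readable cells; it relates equal replies $v@m'$ with $\mathrm{acc}(m,m')$. * $\mathit{wt}$ relates (with equal symbol tables) equal queries whose arguments have the types given by the signature, and equal replies whose value has the result type. * $\mathit{CA}_{\mathit{injp}}$ (worlds $((j,m_1,m_2),\mathit{sg},rs)$, symbol tables as for $\mathit{injp}$) relates $v_f[\mathit{sg}](\vec v)@m_1$ to $rs@m_2$ if $j\vdash m_1\hookrightarrow m_2$; $v_f\neq\mathrm{Vundef}$ and $j\vdash v_f\hookrightarrow rs(\mathrm{PC})$; the arguments are injected into the contents of the argument locations of the System V calling convention; the outgoing-argument area on the stack is out of reach of $j$ from $m_1$ and freeable in $m_2$; $rs(\mathrm{RSP})$ is a pointer to a valid block; and $rs(\mathrm{RA})\ne\mathrm{Vundef}$ has pointer type. It relates $v@m_1'$ to $rs'@m_2'$ if there is $j'$ with $(j,m_1,m_2)\leadsto(j',m_1',m_2')$ and $j'\vdash m_1'\hookrightarrow m_2'$, $v$ is injected by $j'$ into the result register, the outgoing-argument area is out of reach of $j$ from $m_1$, $rs'(\mathrm{RSP})=rs(\mathrm{RSP})$, $rs'(\mathrm{PC})=rs(\mathrm{RA})$, and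 callee-save registers are unchanged. * $\mathit{asm}_{\mathit{injp}}$ relates assembly queries with injected memories and injected registers (source $\mathrm{PC}$ defined) at a world of $\mathit{injp}$ (symbol tables as for $\mathit{injp}$), and replies with injected memories and registers at some $\leadsto$-accessible world. Then $$L_S\leqslant_{\mathbb{C}}[\![\mathtt{server\_opt.s}]\!].$$ -/

import Mathlib

namespace CompCertO

open Classical

/-! # Values and types

64-bit x86 (`ptr64 = true`). Machine integers are bit vectors, pointer offsets are 64-bit
integers, and floating-point numbers are given by their IEEE 754 bit patterns (no floating-point
operation occurs below). Memory blocks are identified by natural numbers. -/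

abbrev Ident := ℕ
abbrev Ptrofs := BitVec 64

inductive Val where
  | Vundef
  | Vint (n : BitVec 32)
  | Vlong (n : BitVec 64)
  | Vfloat (bits : BitVec 64)
  | Vsingle (bits : BitVec 32)
  | Vptr (b : ℕ) (ofs : Ptrofs)

inductive Typ where
  | Tint | Tfloat | Tlong | Tsingle | Tany32 | Tany64

/-- The type of pointers. -/
def Typ.Tptr : Typ := .Tlong

namespace Val

def HasType : Val → Typ → Prop
  | Vundef, _ => True
  | Vint _, .Tint => True
  | Vlong _, .Tlong => True
  | Vfloat _, .Tfloat => True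
  | Vsingle _, .Tsingle => True
  | Vptr _ _, .Tlong => True
  | Vint _, .Tany32 => True
  | Vsingle _, .Tany32 => True
  | _, .Tany64 => True
  | _, _ => False

def xor : Val → Val → Val
  | Vint a, Vint b => Vint (a ^^^ b)
  | _, _ => Vundef

/-- 64-bit addition, including pointer arithmetic. -/
def addl : Val → Val → Val
  | Vlong a, Vlong b => Vlong (a + b)
  | Vptr b o, Vlong n => Vptr b (o + n)
  | Vlong n, Vptr b o => Vptr b (o + n)
  | _, _ => Vundef

/-- 64-bit multiplication. -/
def mull : Val → Val → Val
  | Vlong a, Vlong b => Vlong (a * b)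
  | _, _ => Vundef

def offsetPtr : Val → Ptrofs → Val
  | Vptr b o, d => Vptr b (o + d)
  | _, _ => Vundef

end Val

/-- The unsigned reading of a pointer offset. -/
def Ptrofs.unsigned (o : Ptrofs) : ℤ := (BitVec.toNat o : ℤ)

/-! # Memory chunks, and the encoding of values as sequences of memory cells -/

inductive Chunk where
  | Mint8signed | Mint8unsigned | Mint16signed | Mint16unsigned | Mint32 | Mint64
  | Mfloat32 | Mfloat64 | Many32 | Many64

namespace Chunk

/-- The chunk that holds a pointer. -/
def Mptr : Chunk := Mint64

/-- Size in bytes. -/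
def size : Chunk → ℕ
  | Mint8signed | Mint8unsigned => 1
  | Mint16signed | Mint16unsigned => 2
  | Mint32 | Mfloat32 | Many32 => 4
  | Mint64 | Mfloat64 | Many64 => 8

/-- Required alignment in bytes. -/
def align : Chunk → ℤ
  | Mint8signed | Mint8unsigned => 1
  | Mint16signed | Mint16unsigned => 2
  | Mint32 | Mfloat32 | Many32 | Many64 => 4
  | Mint64 | Mfloat64 => 8

def ofType : Typ → Chunk
  | .Tint => Mint32
  | .Tfloat => Mfloat64
  | .Tlong => Mint64
  | .Tsingle => Mfloat32
  | .Tany32 => Many32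
  | .Tany64 => Many64

end Chunk

inductive Quantity where
  | Q32 | Q64

def Quantity.size : Quantity → ℕ
  | Q32 => 4
  | Q64 => 8

/-- The content of a memory cell: undefined, a concrete byte, or the `n`-th byte-sized fragment of
an opaque value. -/
inductive MemVal where
  | Undef
  | Byte (b : BitVec 8)
  | Fragment (v : Val) (q : Quantity) (n : ℕ)

/-- The `k` low-order bytes of `x`, little-endian. -/
def encodeInt : ℕ → ℕ → List (BitVec 8)
  | 0, _ => []
  | k + 1, x => BitVec.ofNat 8 x :: encodeInt k (x / 256)

def decodeInt : List (BitVec 8) → ℕ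
  | [] => 0
  | b :: l => b.toNat + 256 * decodeInt l

def injBytes (l : List (BitVec 8)) : List MemVal := l.map MemVal.Byte

def projBytes : List MemVal → Option (List (BitVec 8))
  | [] => some []
  | .Byte b :: l => (projBytes l).map (b :: ·)
  | _ :: _ => none

def injValueRec : ℕ → Val → Quantity → List MemVal
  | 0, _, _ => []
  | n + 1, v, q => .Fragment v q n :: injValueRec n v q

/-- All the fragments of an opaque value. -/
def injValue (q : Quantity) (v : Val) : List MemVal := injValueRec q.size v q

noncomputable def projValue (q : Quantity) : List MemVal → Val
  | .Fragment v q' n :: l =>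
      if .Fragment v q' n :: l = injValue q v then v else .Vundef
  | _ => .Vundef

def encodeVal : Chunk → Val → List MemVal
  | .Mint8signed, .Vint n => injBytes (encodeInt 1 n.toNat)
  | .Mint8unsigned, .Vint n => injBytes (encodeInt 1 n.toNat)
  | .Mint16signed, .Vint n => injBytes (encodeInt 2 n.toNat)
  | .Mint16unsigned, .Vint n => injBytes (encodeInt 2 n.toNat)
  | .Mint32, .Vint n => injBytes (encodeInt 4 n.toNat)
  | .Mint64, .Vlong n => injBytes (encodeInt 8 n.toNat)
  | .Mint64, .Vptr b o => injValue .Q64 (.Vptr b o)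
  | .Mfloat32, .Vsingle f => injBytes (encodeInt 4 f.toNat)
  | .Mfloat64, .Vfloat f => injBytes (encodeInt 8 f.toNat)
  | .Many32, v => injValue .Q32 v
  | .Many64, v => injValue .Q64 v
  | c, _ => List.replicate c.size .Undef

/-- The value obtained by reading a value through a chunk. -/
def loadResult : Chunk → Val → Val
  | .Mint8signed, .Vint n => .Vint ((n.truncate 8).signExtend 32)
  | .Mint8unsigned, .Vint n => .Vint ((n.truncate 8).zeroExtend 32)
  | .Mint16signed, .Vint n => .Vint ((n.truncate 16).signExtend 32)
  | .Mint16unsigned, .Vint n => .Vint ((n.truncate 16).zeroExtend 32)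
  | .Mint32, .Vint n => .Vint n
  | .Mint64, .Vlong n => .Vlong n
  | .Mint64, .Vptr b o => .Vptr b o
  | .Mfloat32, .Vsingle f => .Vsingle f
  | .Mfloat64, .Vfloat f => .Vfloat f
  | .Many32, .Vint n => .Vint n
  | .Many32, .Vsingle f => .Vsingle f
  | .Many64, v => v
  | _, _ => .Vundef

noncomputable def decodeVal (c : Chunk) (l : List MemVal) : Val :=
  match projBytes l with
  | some bl =>
      match c with
      | .Mint8signed => .Vint ((BitVec.ofNat 8 (decodeInt bl)).signExtend 32)
      | .Mint8unsigned => .Vint ((BitVec.ofNat 8 (decodeInt bl)).zeroExtend 32)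
      | .Mint16signed => .Vint ((BitVec.ofNat 16 (decodeInt bl)).signExtend 32)
      | .Mint16unsigned => .Vint ((BitVec.ofNat 16 (decodeInt bl)).zeroExtend 32)
      | .Mint32 => .Vint (BitVec.ofNat 32 (decodeInt bl))
      | .Mint64 => .Vlong (BitVec.ofNat 64 (decodeInt bl))
      | .Mfloat32 => .Vsingle (BitVec.ofNat 32 (decodeInt bl))
      | .Mfloat64 => .Vfloat (BitVec.ofNat 64 (decodeInt bl))
      | .Many32 | .Many64 => .Vundef
  | none =>
      match c with
      | .Many32 => loadResult .Many32 (projValue .Q32 l)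
      | .Mint64 => loadResult .Mint64 (projValue .Q64 l)
      | .Many64 => loadResult .Many64 (projValue .Q64 l)
      | _ => .Vundef

/-! # The block-based memory model -/

inductive Permission where
  | Freeable | Writable | Readable | Nonempty

/-- `p ≥ q` as permissions iff `q.rank ≤ p.rank`. -/
def Permission.rank : Permission → ℕ
  | Nonempty => 0
  | Readable => 1
  | Writable => 2
  | Freeable => 3

/-- Maximal and current permissions. -/
inductive PermKind where
  | Max | Cur

structure Mem where
  contents : ℕ → ℤ → MemVal
  access : ℕ → ℤ → PermKind → Option Permission
  nextblock : ℕ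
  access_max : ∀ b o p, access b o .Cur = some p →
    ∃ q, access b o .Max = some q ∧ p.rank ≤ q.rank
  noaccess : ∀ b o k, nextblock ≤ b → access b o k = none

namespace Mem

def Valid (m : Mem) (b : ℕ) : Prop := b < m.nextblock

def Perm (m : Mem) (b : ℕ) (o : ℤ) (k : PermKind) (p : Permission) : Prop :=
  ∃ q, m.access b o k = some q ∧ p.rank ≤ q.rank

def RangePerm (m : Mem) (b : ℕ) (lo hi : ℤ) (k : PermKind) (p : Permission) : Prop :=
  ∀ o, lo ≤ o → o < hi → m.Perm b o k p

def ValidAccess (m : Mem) (c : Chunk) (b : ℕ) (o : ℤ) (p : Permission) : Prop :=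
  m.RangePerm b o (o + c.size) .Cur p ∧ c.align ∣ o

/-- The contents of the `n` cells from `(b, o)` on. -/
def getN (m : Mem) (b : ℕ) : ℕ → ℤ → List MemVal
  | 0, _ => []
  | n + 1, o => m.contents b o :: getN m b n (o + 1)

noncomputable def load (c : Chunk) (m : Mem) (b : ℕ) (o : ℤ) : Option Val :=
  if m.ValidAccess c b o .Readable then some (decodeVal c (m.getN b c.size o)) else none

/-- Overwrite the cells from `(b, o)` on with the list `l`. -/
noncomputable def setN (m : Mem) (b : ℕ) (o : ℤ) (l : List MemVal) : Mem where
  contents b' o' :=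
    if b' = b ∧ o ≤ o' ∧ o' < o + l.length then l.getD (o' - o).toNat .Undef
    else m.contents b' o'
  access := m.access
  nextblock := m.nextblock
  access_max := m.access_max
  noaccess := m.noaccess

noncomputable def store (c : Chunk) (m : Mem) (b : ℕ) (o : ℤ) (v : Val) : Option Mem :=
  if m.ValidAccess c b o .Writable then some (m.setN b o (encodeVal c v)) else none

noncomputable def loadv (c : Chunk) (m : Mem) : Val → Option Val
  | .Vptr b o => m.load c b (Ptrofs.unsigned o)
  | _ => none

noncomputable def storev (c : Chunk) (m : Mem) (a v : Val) : Option Mem :=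
  match a with
  | .Vptr b o => m.store c b (Ptrofs.unsigned o) v
  | _ => none

/-- Allocation of a fresh block, which is `m.nextblock`, with freeable cells from `lo` to `hi`
(excluded) and undefined contents. -/
noncomputable def alloc (m : Mem) (lo hi : ℤ) : Mem × ℕ :=
  ({ contents := fun b o => if b = m.nextblock then .Undef else m.contents b o
     access := fun b o k =>
       if b = m.nextblock then (if lo ≤ o ∧ o < hi then some .Freeable else none)
       else m.access b o k
     nextblock := m.nextblock + 1
     access_max := by
       intro b o p h
       by_cases hb : b = m.nextblock
       · simp only [hb, if_true] at h ⊢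
         exact ⟨p, h, le_refl _⟩
       · simp only [hb, if_false] at h ⊢
         exact m.access_max b o p h
     noaccess := by
       intro b o k h
       have hb : b ≠ m.nextblock := by omega
       simp only [hb, if_false]
       exact m.noaccess b o k (by omega) }, m.nextblock)

noncomputable def free (m : Mem) (b : ℕ) (lo hi : ℤ) : Option Mem :=
  if m.RangePerm b lo hi .Cur .Freeable then
    some
      { contents := m.contents
        access := fun b' o k => if b' = b ∧ lo ≤ o ∧ o < hi then none else m.access b' o k
        nextblock := m.nextblock
        access_max := by
          intro b' o p h
          by_cases hb : b' = b ∧ lo ≤ o ∧ o < hi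
          · simp [hb] at h
          · simp only [hb, if_false] at h ⊢
            exact m.access_max b' o p h
        noaccess := by
          intro b' o k h
          by_cases hb : b' = b ∧ lo ≤ o ∧ o < hi
          · simp [hb]
          · simp only [hb, if_false]
            exact m.noaccess b' o k h }
  else none

end Mem

/-! # Memory injections -/

abbrev MemInj := ℕ → Option (ℕ × ℤ)

inductive Val.Inject (j : MemInj) : Val → Val → Prop
  | undef (v : Val) : Val.Inject j .Vundef v
  | int (n : BitVec 32) : Val.Inject j (.Vint n) (.Vint n)
  | long (n : BitVec 64) : Val.Inject j (.Vlong n) (.Vlong n)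
  | float (n : BitVec 64) : Val.Inject j (.Vfloat n) (.Vfloat n)
  | single (n : BitVec 32) : Val.Inject j (.Vsingle n) (.Vsingle n)
  | ptr (b₁ b₂ : ℕ) (o₁ : Ptrofs) (δ : ℤ) (h : j b₁ = some (b₂, δ)) :
      Val.Inject j (.Vptr b₁ o₁) (.Vptr b₂ (o₁ + BitVec.ofInt 64 δ))

inductive MemVal.Inject (j : MemInj) : MemVal → MemVal → Prop
  | undef (mv : MemVal) : MemVal.Inject j .Undef mv
  | byte (b : BitVec 8) : MemVal.Inject j (.Byte b) (.Byte b)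
  | frag (v₁ v₂ : Val) (q : Quantity) (n : ℕ) (h : Val.Inject j v₁ v₂) :
      MemVal.Inject j (.Fragment v₁ q n) (.Fragment v₂ q n)

/-- `m₁` is injected into `m₂` by `j`. -/
structure Mem.Inject (j : MemInj) (m₁ m₂ : Mem) : Prop where
  perm : ∀ b₁ b₂ δ o k p, j b₁ = some (b₂, δ) → m₁.Perm b₁ o k p → m₂.Perm b₂ (o + δ) k p
  align : ∀ b₁ b₂ δ o p (c : Chunk), j b₁ = some (b₂, δ) →
    m₁.RangePerm b₁ o (o + c.size) .Max p → c.align ∣ δ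
  memval : ∀ b₁ b₂ δ o, j b₁ = some (b₂, δ) → m₁.Perm b₁ o .Cur .Readable →
    MemVal.Inject j (m₁.contents b₁ o) (m₂.contents b₂ (o + δ))
  freeblocks : ∀ b, ¬ m₁.Valid b → j b = none
  mappedblocks : ∀ b₁ b₂ δ, j b₁ = some (b₂, δ) → m₂.Valid b₂
  no_overlap : ∀ b₁ b₂ δ o b₁' b₂' δ' o', b₁ ≠ b₁' → j b₁ = some (b₂, δ) →
    j b₁' = some (b₂', δ') → m₁.Perm b₁ o .Max .Nonempty → m₁.Perm b₁' o' .Max .Nonempty →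
    b₂ ≠ b₂' ∨ o + δ ≠ o' + δ'
  representable : ∀ b₁ b₂ δ (o : Ptrofs), j b₁ = some (b₂, δ) →
    m₁.Perm b₁ (Ptrofs.unsigned o) .Max .Nonempty ∨
      m₁.Perm b₁ (Ptrofs.unsigned o - 1) .Max .Nonempty →
    0 ≤ δ ∧ Ptrofs.unsigned o + δ < 2 ^ 64
  perm_inv : ∀ b₁ b₂ δ o k p, j b₁ = some (b₂, δ) → m₂.Perm b₂ (o + δ) k p →
    m₁.Perm b₁ o k p ∨ ¬ m₁.Perm b₁ o .Max .Nonempty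

/-- The permissions and the readable contents of the cells in `P` do not change. -/
structure Mem.UnchangedOn (P : ℕ → ℤ → Prop) (m m' : Mem) : Prop where
  perm : ∀ b o k p, P b o → m.Valid b → (m.Perm b o k p ↔ m'.Perm b o k p)
  contents : ∀ b o, P b o → m.Perm b o .Cur .Readable → m'.contents b o = m.contents b o

def MemInj.Unmapped (j : MemInj) (b : ℕ) (_ : ℤ) : Prop := j b = none

def MemInj.OutOfReach (j : MemInj) (m₁ : Mem) (b₂ : ℕ) (o₂ : ℤ) : Prop :=
  ∀ b₁ δ, j b₁ = some (b₂, δ) → ¬ m₁.Perm b₁ (o₂ - δ) .Max .Nonempty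

def MemInj.Incl (j j' : MemInj) : Prop := ∀ b x, j b = some x → j' b = some x

/-- Maximal permissions of valid blocks can only decrease. -/
def Mem.MaxPermDecrease (m m' : Mem) : Prop :=
  ∀ b o p, m.Valid b → m'.Perm b o .Max p → m.Perm b o .Max p

/-- Read-only data keep their values. -/
def Mem.RoAcc (m m' : Mem) : Prop :=
  ∀ b o, m.Valid b → ¬ m.Perm b o .Max .Writable → m'.Perm b o .Cur .Readable →
    m.contents b o = m'.contents b o ∧ m.Perm b o .Cur .Readable

/-- `mem-acc`. -/
structure Mem.Acc (m m' : Mem) : Prop where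
  valid : ∀ b, m.Valid b → m'.Valid b
  max_perm : m.MaxPermDecrease m'
  ro : m.RoAcc m'

/-- New mappings only relate blocks that are new on both sides. -/
def InjSeparated (j j' : MemInj) (m₁ m₂ : Mem) : Prop :=
  ∀ b₁ b₂ δ, j b₁ = none → j' b₁ = some (b₂, δ) → ¬ m₁.Valid b₁ ∧ ¬ m₂.Valid b₂

/-! # The Kripke memory relation `injp` -/

structure InjpWorld where
  inj : MemInj
  src : Mem
  tgt : Mem

/-- The accessibility relation of `injp`. -/
structure InjpWorld.Acc (w w' : InjpWorld) : Prop where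
  incr : w.inj.Incl w'.inj
  unmapped : Mem.UnchangedOn w.inj.Unmapped w.src w'.src
  outOfReach : Mem.UnchangedOn (w.inj.OutOfReach w.src) w.tgt w'.tgt
  accSrc : w.src.Acc w'.src
  accTgt : w.tgt.Acc w'.tgt
  separated : InjSeparated w.inj w'.inj w.src w.tgt

/-- The relation on memories at a world of `injp`. -/
def InjpWorld.Rel (w : InjpWorld) (m₁ m₂ : Mem) : Prop :=
  m₁ = w.src ∧ m₂ = w.tgt ∧ Mem.Inject w.inj m₁ m₂

/-! # Global definitions and symbol tables -/

inductive InitData where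
  | int8 (n : BitVec 32)
  | int16 (n : BitVec 32)
  | int32 (n : BitVec 32)
  | int64 (n : BitVec 64)
  | float32 (bits : BitVec 32)
  | float64 (bits : BitVec 64)
  | space (n : ℕ)
  | addrof (id : Ident) (ofs : Ptrofs)

def InitData.size : InitData → ℕ
  | int8 _ => 1
  | int16 _ => 2
  | int32 _ | float32 _ => 4
  | int64 _ | float64 _ | addrof _ _ => 8
  | space n => n

structure GlobVar where
  init : List InitData
  readonly : Bool
  volatile : Bool

inductive GlobDef (F : Type) where
  | func (f : F)
  | var (v : GlobVar)

/-- A program: the global definitions of a module, for functions of type `F`. Functions that are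
not listed are external to the module. -/
abbrev Program (F : Type) := List (Ident × GlobDef F)

def Program.find {F : Type} (p : Program F) (id : Ident) : Option (GlobDef F) := List.lookup id p

/-- The skeleton of a module: its global definitions without the code. -/
abbrev Skeleton := Program Unit

def GlobDef.erase {F : Type} : GlobDef F → GlobDef Unit
  | func _ => func ()
  | var v => var v

def Program.erase {F : Type} (p : Program F) : Skeleton := p.map fun d => (d.1, d.2.erase)

structure SymTbl where
  symb : Ident → Option ℕ
  info : ℕ → Option (GlobDef Unit)
  next : ℕ
  symb_range : ∀ id b, symb id = some b → b < next
  info_range : ∀ b g, info b = some g → b < next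
  symb_inj : ∀ id id' b, symb id = some b → symb id' = some b → id = id'

/-- Initializers that a linker may replace: none at all stands for an external variable, and blank
space may be replaced by data of the same size. -/
inductive LinkOrderInit : List InitData → List InitData → Prop
  | refl (l : List InitData) : LinkOrderInit l l
  | undefined (l : List InitData) : LinkOrderInit [] l
  | common (n : ℕ) (l : List InitData) (h : (l.map InitData.size).sum = n) :
      LinkOrderInit [.space n] l

inductive LinkOrder : GlobDef Unit → GlobDef Unit → Prop
  | func : LinkOrder (.func ()) (.func ())
  | var (v v' : GlobVar) (hr : v.readonly = v'.readonly) (hv : v.volatile = v'.volatile)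
      (hi : LinkOrderInit v.init v'.init) : LinkOrder (.var v) (.var v')

/-- The symbol table provides every definition of the skeleton. -/
def SymTbl.ValidFor (se : SymTbl) (sk : Skeleton) : Prop :=
  ∀ id g, sk.find id = some g → ∃ b g', se.symb id = some b ∧ se.info b = some g' ∧ LinkOrder g g'

/-- The block `b` holds the function `f` of the program `p`. -/
def Program.FunctAt {F : Type} (p : Program F) (se : SymTbl) (b : ℕ) (f : F) : Prop :=
  ∃ id, se.symb id = some b ∧ p.find id = some (.func f)

/-- The value is a pointer to a function that `p` defines. -/
def Program.IsInternal {F : Type} (p : Program F) (se : SymTbl) (v : Val) : Prop :=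
  ∃ b f, v = .Vptr b 0 ∧ p.FunctAt se b f

/-- The value is a pointer to a function that is known to the symbol table and that `p` does not
define. -/
def Program.IsExternal {F : Type} (p : Program F) (se : SymTbl) (v : Val) : Prop :=
  ∃ b, v = .Vptr b 0 ∧ se.info b = some (.func ()) ∧ ∀ id, se.symb id = some b → p.find id = none

/-- Two symbol tables are related by an injection. -/
structure SymTbl.Match (j : MemInj) (se₁ se₂ : SymTbl) : Prop where
  dom : ∀ b₁, b₁ < se₁.next → ∃ b₂, j b₁ = some (b₂, 0)
  img : ∀ b₂, b₂ < se₂.next → ∃ b₁, j b₁ = some (b₂, 0)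
  symb : ∀ b₁ b₂ δ, j b₁ = some (b₂, δ) → ∀ id, se₁.symb id = some b₁ ↔ se₂.symb id = some b₂
  info : ∀ b₁ b₂ δ, j b₁ = some (b₂, δ) → se₁.info b₁ = se₂.info b₂
  separated : ∀ b₁ b₂ δ, j b₁ = some (b₂, δ) → (b₁ < se₁.next ↔ b₂ < se₂.next)

/-- Symbol tables related at a world of `injp`. -/
structure InjpWorld.MatchSenv (w : InjpWorld) (se₁ se₂ : SymTbl) : Prop where
  stbls : SymTbl.Match w.inj se₁ se₂
  src : se₁.next ≤ w.src.nextblock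
  tgt : se₂.next ≤ w.tgt.nextblock

/-! # Language interfaces, open labeled transition systems, simulation conventions -/

structure LangInterface where
  Query : Type
  Reply : Type

inductive EventVal where
  | EVint (n : BitVec 32)
  | EVlong (n : BitVec 64)
  | EVfloat (bits : BitVec 64)
  | EVsingle (bits : BitVec 32)
  | EVptr (id : Ident) (ofs : Ptrofs)

inductive Event where
  | syscall (name : String) (args : List EventVal) (res : EventVal)
  | vload (c : Chunk) (id : Ident) (ofs : Ptrofs) (v : EventVal)
  | vstore (c : Chunk) (id : Ident) (ofs : Ptrofs) (v : EventVal)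
  | annot (text : String) (args : List EventVal)

abbrev Trace := List Event

/-- An open LTS with outgoing interface `A` and incoming interface `B`. -/
structure LTS (A B : LangInterface) where
  /-- internal states, `S` -/
  State : Type
  /-- accepted incoming queries, `D` -/
  valid : B.Query → Prop
  /-- `I` -/
  initial : B.Query → State → Prop
  /-- internal steps -/
  step : State → Trace → State → Prop
  /-- `F` -/
  final : State → B.Reply → Prop
  /-- `X` -/
  external : State → A.Query → Prop
  /-- `Y` -/
  after : State → A.Reply → State → Prop
  initial_valid : ∀ q s, initial q s → valid q

/-- Finitely many internal steps; the traces are concatenated. -/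
inductive LTS.Star {A B : LangInterface} (L : LTS A B) : L.State → Trace → L.State → Prop
  | refl (s : L.State) : LTS.Star L s [] s
  | step (s s' s'' : L.State) (t t' : Trace) (h : L.step s t s') (hs : LTS.Star L s' t' s'') :
      LTS.Star L s (t ++ t') s''

/-- The open semantics of a module: its global definitions, and an open LTS for every symbol
table. -/
structure OpenSem (A B : LangInterface) where
  skel : Skeleton
  activate : SymTbl → LTS A B

/-- A simulation convention: Kripke worlds, and the symbol tables, queries and replies that are
related at each world. -/
structure SimConv (A B : LangInterface) where
  World : Type
  senv : World → SymTbl → SymTbl → Prop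
  query : World → A.Query → B.Query → Prop
  reply : World → A.Reply → B.Reply → Prop

/-- Composition of simulation conventions. -/
def SimConv.comp {A B C : LangInterface} (R : SimConv A B) (S : SimConv B C) : SimConv A C where
  World := SymTbl × R.World × S.World
  senv w se₁ se₃ := R.senv w.2.1 se₁ w.1 ∧ S.senv w.2.2 w.1 se₃
  query w q₁ q₃ := ∃ q₂, R.query w.2.1 q₁ q₂ ∧ S.query w.2.2 q₂ q₃
  reply w r₁ r₃ := ∃ r₂, R.reply w.2.1 r₁ r₂ ∧ S.reply w.2.2 r₂ r₃

/-- The five conditions on an invariant `R` between two open LTS, at a world `w` of the incoming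
convention. -/
structure LTS.IsSimulation {A₁ A₂ B₁ B₂ : LangInterface} (RA : SimConv A₁ A₂) (RB : SimConv B₁ B₂)
    (se₁ se₂ : SymTbl) (w : RB.World) (L₁ : LTS A₁ B₁) (L₂ : LTS A₂ B₂)
    (R : L₁.State → L₂.State → Prop) : Prop where
  valid : ∀ q₁ q₂, RB.query w q₁ q₂ → (L₁.valid q₁ ↔ L₂.valid q₂)
  initial : ∀ q₁ q₂ s₁, RB.query w q₁ q₂ → L₁.initial q₁ s₁ → ∃ s₂, R s₁ s₂ ∧ L₂.initial q₂ s₂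
  step : ∀ s₁ s₂ t s₁', R s₁ s₂ → L₁.step s₁ t s₁' → ∃ s₂', R s₁' s₂' ∧ L₂.Star s₂ t s₂'
  external : ∀ s₁ s₂ q₁, R s₁ s₂ → L₁.external s₁ q₁ →
    ∃ wA q₂, RA.senv wA se₁ se₂ ∧ RA.query wA q₁ q₂ ∧ L₂.external s₂ q₂ ∧
      ∀ r₁ r₂ s₁', RA.reply wA r₁ r₂ → L₁.after s₁ r₁ s₁' → ∃ s₂', R s₁' s₂' ∧ L₂.after s₂ r₂ s₂'
  final : ∀ s₁ s₂ r₁, R s₁ s₂ → L₁.final s₁ r₁ → ∃ r₂, RB.reply w r₁ r₂ ∧ L₂.final s₂ r₂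

/-- Open forward simulation of `L₁` (source, specification) by `L₂` (target, implementation). -/
def OpenSim {A₁ A₂ B₁ B₂ : LangInterface} (RA : SimConv A₁ A₂) (RB : SimConv B₁ B₂)
    (L₁ : OpenSem A₁ B₁) (L₂ : OpenSem A₂ B₂) : Prop :=
  L₁.skel = L₂.skel ∧
  ∃ R : ∀ (_ : RB.World) (se₁ se₂ : SymTbl),
      (L₁.activate se₁).State → (L₂.activate se₂).State → Prop,
    ∀ w se₁ se₂, RB.senv w se₁ se₂ → se₁.ValidFor L₁.skel →
      LTS.IsSimulation RA RB se₁ se₂ w (L₁.activate se₁) (L₂.activate se₂) (R w se₁ se₂)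

/-! # The C and assembly interfaces -/

inductive RetType where
  | Tret (t : Typ)
  | Tbool | Tint8signed | Tint8unsigned | Tint16signed | Tint16unsigned | Tvoid

/-- The type of the value returned (a function without result counts as returning `Tint`). -/
def RetType.proj : RetType → Typ
  | Tret t => t
  | _ => .Tint

structure CallConv where
  vararg : Option ℤ
  unproto : Bool
  structret : Bool

structure Signature where
  args : List Typ
  res : RetType
  cc : CallConv

def CallConv.default : CallConv := ⟨none, false, false⟩

structure CQuery where
  vf : Val
  sg : Signature
  args : List Val
  mem : Mem

structure CReply where
  res : Val
  mem : Mem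

/-- The language interface of C. -/
def liC : LangInterface := ⟨CQuery, CReply⟩

inductive IReg where
  | RAX | RBX | RCX | RDX | RSI | RDI | RBP | RSP
  | R8 | R9 | R10 | R11 | R12 | R13 | R14 | R15

inductive CRBit where
  | ZF | CF | PF | SF | OF

/-- Registers of x86-64: program counter, integer registers, vector registers, top of the x87
stack, flags, and the pseudo-register for the return address. -/
inductive PReg where
  | PC
  | IR (r : IReg)
  | FR (i : Fin 16)
  | ST0
  | CR (c : CRBit)
  | RA

abbrev RegSet := PReg → Val

noncomputable def RegSet.set (rs : RegSet) (r : PReg) (v : Val) : RegSet :=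
  fun r' => if r' = r then v else rs r'

/-- The stack pointer. -/
abbrev PReg.SP : PReg := .IR .RSP

structure AsmState where
  rs : RegSet
  mem : Mem

/-- The language interface of assembly: queries and replies are register sets with memories. -/
def liAsm : LangInterface := ⟨AsmState, AsmState⟩

/-! # The C calling convention for x86-64 (System V) -/

/-- Location of an argument: a register, or a slot of the outgoing arguments area at an offset
counted in 4-byte words. -/
inductive ArgLoc where
  | reg (r : PReg)
  | slot (ofs : ℕ) (ty : Typ)

def intParamRegs : List PReg := [.IR .RDI, .IR .RSI, .IR .RDX, .IR .RCX, .IR .R8, .IR .R9]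

def floatParamRegs : List PReg := [.FR 0, .FR 1, .FR 2, .FR 3, .FR 4, .FR 5, .FR 6, .FR 7]

/-- Arguments are passed in the integer and vector registers that are left, then on the stack. -/
def locArgumentsRec : List Typ → List PReg → List PReg → ℕ → List ArgLoc
  | [], _, _, _ => []
  | ty :: tys, ir, fr, ofs =>
      match ty with
      | .Tfloat | .Tsingle =>
          match fr with
          | [] => .slot ofs ty :: locArgumentsRec tys ir [] (ofs + 2)
          | r :: fr' => .reg r :: locArgumentsRec tys ir fr' ofs
      | _ =>
          match ir with
          | [] => .slot ofs ty :: locArgumentsRec tys [] fr (ofs + 2)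
          | r :: ir' => .reg r :: locArgumentsRec tys ir' fr ofs

def locArguments (sg : Signature) : List ArgLoc :=
  locArgumentsRec sg.args intParamRegs floatParamRegs 0

/-- Size of a type in 4-byte words. -/
def Typ.words : Typ → ℕ
  | .Tint | .Tsingle | .Tany32 => 1
  | .Tlong | .Tfloat | .Tany64 => 2

/-- Size of the outgoing arguments area, in 4-byte words. -/
def sizeArguments (sg : Signature) : ℕ :=
  (locArguments sg).foldl (fun n l => match l with
    | .reg _ => n
    | .slot ofs ty => max n (ofs + ty.words)) 0

noncomputable def getArg (sp : Val) (rs : RegSet) (m : Mem) : ArgLoc → Val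
  | .reg r => rs r
  | .slot ofs ty =>
      (m.loadv (Chunk.ofType ty) (sp.offsetPtr (BitVec.ofNat 64 (4 * ofs)))).getD .Vundef

/-- `get-args`. -/
noncomputable def getArgs (sg : Signature) (sp : Val) (rs : RegSet) (m : Mem) : List Val :=
  (locArguments sg).map (getArg sp rs m)

/-- `outgoing-arguments`: the cells of the outgoing arguments area. -/
def OutgoingArguments (sg : Signature) (sp : Val) (b : ℕ) (o : ℤ) : Prop :=
  ∃ so : Ptrofs, sp = .Vptr b so ∧
    Ptrofs.unsigned so ≤ o ∧ o < Ptrofs.unsigned so + 4 * sizeArguments sg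

def locResult (sg : Signature) : PReg :=
  match sg.res.proj with
  | .Tfloat | .Tsingle => .FR 0
  | _ => .IR .RAX

/-- `get-result`. -/
def getResult (sg : Signature) (rs : RegSet) : Val := rs (locResult sg)

def calleeSaveRegs : List PReg := [.IR .RBX, .IR .RBP, .IR .R12, .IR .R13, .IR .R14, .IR .R15]

/-! # The direct simulation convention -/

/-- The initial contents of a global variable. -/
def InitData.bytes (se : SymTbl) : InitData → List MemVal
  | int8 n => injBytes (encodeInt 1 n.toNat)
  | int16 n => injBytes (encodeInt 2 n.toNat)
  | int32 n => injBytes (encodeInt 4 n.toNat)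
  | int64 n => injBytes (encodeInt 8 n.toNat)
  | float32 f => injBytes (encodeInt 4 f.toNat)
  | float64 f => injBytes (encodeInt 8 f.toNat)
  | space n => List.replicate n (.Byte 0)
  | addrof id ofs =>
      match se.symb id with
      | some b => injValue .Q64 (.Vptr b ofs)
      | none => List.replicate 8 .Undef

/-- The variable is a constant: read-only, not volatile, and with an initializer that linking
cannot replace. -/
def GlobVar.IsConst (v : GlobVar) : Prop :=
  v.readonly = true ∧ v.volatile = false ∧ v.init ≠ [] ∧ ∀ n, v.init ≠ [.space n]

/-- `ro-valid`: the global constants in `m` are not writable and have their initial values. -/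
structure RoValid (se : SymTbl) (m : Mem) : Prop where
  next : se.next ≤ m.nextblock
  values : ∀ id b v, se.symb id = some b → se.info b = some (.var v) → v.IsConst →
    ∀ (n : ℕ) (mv : MemVal), (v.init.flatMap (InitData.bytes se))[n]? = some mv →
      m.Perm b n .Cur .Readable → m.contents b n = mv
  nonwritable : ∀ id b v, se.symb id = some b → se.info b = some (.var v) → v.IsConst →
    ∀ o, ¬ m.Perm b o .Max .Writable

/-- The semantic invariant `ro`. -/
def ccRo : SimConv liC liC where
  World := SymTbl × Mem
  senv w se₁ se₂ := se₁ = w.1 ∧ se₂ = w.1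
  query w (q₁ q₂ : CQuery) := q₁ = q₂ ∧ q₁.mem = w.2 ∧ RoValid w.1 w.2
  reply w (r₁ r₂ : CReply) := r₁ = r₂ ∧ w.2.Acc r₁.mem

/-- The semantic invariant `wt`: arguments and results respect the signature. -/
def ccWt : SimConv liC liC where
  World := SymTbl × Signature
  senv w se₁ se₂ := se₁ = w.1 ∧ se₂ = w.1
  query w (q₁ q₂ : CQuery) := q₁ = q₂ ∧ q₁.sg = w.2 ∧ List.Forall₂ Val.HasType q₁.args w.2.args
  reply w (r₁ r₂ : CReply) := r₁ = r₂ ∧ r₁.res.HasType w.2.res.proj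

structure CAWorld where
  injp : InjpWorld
  sg : Signature
  rs : RegSet

/-- Queries related by `CAinjp`. -/
structure CAQuery (w : CAWorld) (q₁ : CQuery) (q₂ : AsmState) : Prop where
  sg : q₁.sg = w.sg
  rs : q₂.rs = w.rs
  mem : w.injp.Rel q₁.mem q₂.mem
  vf : Val.Inject w.injp.inj q₁.vf (w.rs .PC)
  args : List.Forall₂ (Val.Inject w.injp.inj) q₁.args (getArgs w.sg (w.rs .SP) w.rs q₂.mem)
  outOfReach : ∀ b o, OutgoingArguments w.sg (w.rs .SP) b o → w.injp.inj.OutOfReach q₁.mem b o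
  freeable : ∀ b o, OutgoingArguments w.sg (w.rs .SP) b o → q₂.mem.Perm b o .Cur .Freeable
  vf_def : q₁.vf ≠ .Vundef
  sp_valid : ∃ b o, w.rs .SP = .Vptr b o ∧ q₂.mem.Valid b
  ra_def : w.rs .RA ≠ .Vundef
  ra_type : (w.rs .RA).HasType .Tptr

/-- Replies related by `CAinjp`. -/
structure CAReply (w : CAWorld) (r₁ : CReply) (r₂ : AsmState) (w' : InjpWorld) : Prop where
  acc : w.injp.Acc w'
  mem : w'.Rel r₁.mem r₂.mem
  res : Val.Inject w'.inj r₁.res (getResult w.sg r₂.rs)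
  outOfReach : ∀ b o, OutgoingArguments w.sg (w.rs .SP) b o →
    w.injp.inj.OutOfReach w.injp.src b o
  sp : r₂.rs .SP = w.rs .SP
  pc : r₂.rs .PC = w.rs .RA
  calleeSave : ∀ r ∈ calleeSaveRegs, r₂.rs r = w.rs r

/-- The C calling convention with memory protection, `CAinjp`. -/
def ccCAinjp : SimConv liC liAsm where
  World := CAWorld
  senv w := w.injp.MatchSenv
  query := CAQuery
  reply w r₁ r₂ := ∃ w', CAReply w r₁ r₂ w'

/-- The assembly-level convention over `injp`. -/
def ccAsmInjp : SimConv liAsm liAsm where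
  World := InjpWorld
  senv w := w.MatchSenv
  query w (q₁ q₂ : AsmState) :=
    w.Rel q₁.mem q₂.mem ∧ (∀ r, Val.Inject w.inj (q₁.rs r) (q₂.rs r)) ∧ q₁.rs .PC ≠ .Vundef
  reply w (r₁ r₂ : AsmState) :=
    ∃ w' : InjpWorld, w.Acc w' ∧ w'.Rel r₁.mem r₂.mem ∧
      ∀ r, Val.Inject w'.inj (r₁.rs r) (r₂.rs r)

/-- The direct convention: `ro · wt · CAinjp · asm_injp`. -/
def ccDirect : SimConv liC liAsm := ccRo.comp (ccWt.comp (ccCAinjp.comp ccAsmInjp))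

/-! # Open semantics of assembly modules

The instruction type lists the instructions that hand-written modules use below. -/

/-- Addressing mode: optional base, optional scaled index, and a constant or a symbol plus an
offset. -/
structure AddrMode where
  base : Option IReg
  index : Option (IReg × ℤ)
  const : ℤ ⊕ (Ident × Ptrofs)

inductive Instr where
  /-- `rd := rd XOR n` (32 bits) -/
  | Pxorl_ri (rd : IReg) (n : BitVec 32)
  /-- store the low 32 bits of `r` at address `a` -/
  | Pmovl_mr (a : AddrMode) (r : IReg)
  /-- `rd :=` address `a` -/
  | Pleaq (rd : IReg) (a : AddrMode)
  /-- call the function whose address is in `r` -/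
  | Pcall_r (r : IReg) (sg : Signature)
  | Pret
  | Pallocframe (sz : ℤ) (ofs_ra ofs_link : Ptrofs)
  | Pfreeframe (sz : ℤ) (ofs_ra ofs_link : Ptrofs)

structure AsmFunction where
  sg : Signature
  code : List Instr

abbrev AsmProgram := Program AsmFunction

noncomputable def evalAddrMode (se : SymTbl) (a : AddrMode) (rs : RegSet) : Val :=
  Val.addl
    (match a.base with
      | none => .Vlong 0
      | some r => rs (.IR r))
    (Val.addl
      (match a.index with
        | none => .Vlong 0
        | some (r, sc) =>
            if sc = 1 then rs (.IR r) else Val.mull (rs (.IR r)) (.Vlong (BitVec.ofInt 64 sc)))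
      (match a.const with
        | .inl n => .Vlong (BitVec.ofInt 64 n)
        | .inr (id, ofs) =>
            match se.symb id with
            | some b => .Vptr b ofs
            | none => .Vundef))

/-- Advance the program counter by one instruction. -/
noncomputable def nextInstr (rs : RegSet) : RegSet := rs.set .PC ((rs .PC).offsetPtr 1)

/-- Advance the program counter and forget the flags. -/
noncomputable def nextInstrNf (rs : RegSet) : RegSet :=
  nextInstr fun r => match r with
    | .CR _ => .Vundef
    | r => rs r

/-- Does the stack pointer designate a frame allocated since the module was entered, at a time
when `nb` was the next block? If it does not, then control has gone back to the caller of the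
module. -/
noncomputable def innerSp (nb : ℕ) : Val → Option Bool
  | .Vptr b _ => some (if b < nb then false else true)
  | _ => none

/-- Execution of one instruction. The boolean tells whether control remains in the module; `none`
means that execution is stuck. -/
noncomputable def execInstr (se : SymTbl) (nb : ℕ) (i : Instr) (rs : RegSet) (m : Mem) :
    Option (RegSet × Mem × Bool) :=
  match i with
  | .Pxorl_ri rd n =>
      some (nextInstrNf (rs.set (.IR rd) (Val.xor (rs (.IR rd)) (.Vint n))), m, true)
  | .Pmovl_mr a r =>
      (m.storev .Mint32 (evalAddrMode se a rs) (rs (.IR r))).map fun m' =>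
        (nextInstrNf rs, m', true)
  | .Pleaq rd a => some (nextInstr (rs.set (.IR rd) (evalAddrMode se a rs)), m, true)
  | .Pcall_r r _ =>
      some ((rs.set .RA ((rs .PC).offsetPtr 1)).set .PC (rs (.IR r)), m, true)
  | .Pret => (innerSp nb (rs .SP)).map fun live => (rs.set .PC (rs .RA), m, live)
  | .Pallocframe sz ofs_ra ofs_link =>
      let m₁ := (m.alloc 0 sz).1
      let sp := Val.Vptr (m.alloc 0 sz).2 0
      (m₁.storev .Mptr (sp.offsetPtr ofs_link) (rs .SP)).bind fun m₂ =>
        (m₂.storev .Mptr (sp.offsetPtr ofs_ra) (rs .RA)).map fun m₃ =>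
          (nextInstr ((rs.set (.IR .RAX) (rs .SP)).set .SP sp), m₃, true)
  | .Pfreeframe sz ofs_ra ofs_link =>
      (m.loadv .Mptr ((rs .SP).offsetPtr ofs_ra)).bind fun ra =>
        (m.loadv .Mptr ((rs .SP).offsetPtr ofs_link)).bind fun sp =>
          match rs .SP with
          | .Vptr stk o =>
              (m.free stk (Ptrofs.unsigned o) (Ptrofs.unsigned o + sz)).map fun m' =>
                (nextInstr ((rs.set .SP sp).set .RA ra), m', true)
          | _ => none

/-- Internal states: registers and memory, the next block at the time when the module was entered,
and whether control is still in the module. -/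
structure AsmInternal where
  nb : ℕ
  rs : RegSet
  mem : Mem
  live : Bool

inductive AsmStep (p : AsmProgram) (se : SymTbl) : AsmInternal → Trace → AsmInternal → Prop
  | internal (nb : ℕ) (rs rs' : RegSet) (m m' : Mem) (live : Bool) (b : ℕ) (o : Ptrofs)
      (f : AsmFunction) (i : Instr) (hpc : rs .PC = .Vptr b o) (hf : p.FunctAt se b f)
      (hi : f.code[BitVec.toNat o]? = some i) (he : execInstr se nb i rs m = some (rs', m', live)) :
      AsmStep p se ⟨nb, rs, m, true⟩ [] ⟨nb, rs', m', live⟩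

/-- The open LTS of an assembly module. -/
def asmLTS (p : AsmProgram) (se : SymTbl) : LTS liAsm liAsm where
  State := AsmInternal
  valid (q : AsmState) := p.IsInternal se (q.rs .PC)
  initial (q : AsmState) s := p.IsInternal se (q.rs .PC) ∧ q.rs .SP ≠ .Vundef ∧
    q.rs .RA ≠ .Vundef ∧ s = ⟨q.mem.nextblock, q.rs, q.mem, true⟩
  step := AsmStep p se
  final s (r : AsmState) := s.live = false ∧ r = ⟨s.rs, s.mem⟩
  external s (q : AsmState) := s.live = true ∧ p.IsExternal se (s.rs .PC) ∧ q = ⟨s.rs, s.mem⟩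
  after s (r : AsmState) s' := s.live = true ∧ p.IsExternal se (s.rs .PC) ∧
    ∃ live, innerSp s.nb (r.rs .SP) = some live ∧ s' = ⟨s.nb, r.rs, r.mem, live⟩
  initial_valid _ _ h := h.1

/-- The open semantics of an assembly module. -/
def asmSem (p : AsmProgram) : OpenSem liAsm liAsm where
  skel := p.erase
  activate := asmLTS p

/-! # The encryption server -/

/-- `int × ptr → void`. -/
def intPtrVoidSg : Signature := ⟨[.Tint, .Tptr], .Tvoid, .default⟩

/-- `ptr → void`. -/
def ptrVoidSg : Signature := ⟨[.Tptr], .Tvoid, .default⟩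

/-- The constant `key`, of value 42. -/
def keyVar : GlobVar := ⟨[.int32 42], true, false⟩

/-- The address `8(RSP)`. -/
def slotAddr : AddrMode := ⟨some .RSP, none, .inl 8⟩

/-- The code of the optimized server. -/
def encryptCode : List Instr :=
  [ .Pallocframe 24 16 0,
    .Pxorl_ri .RDI 42,
    .Pmovl_mr slotAddr .RDI,
    .Pleaq .RDI slotAddr,
    .Pcall_r .RSI ptrVoidSg,
    .Pfreeframe 24 16 0,
    .Pret ]

/-- The module `server_opt.s`, for given names of the function and of the constant. -/
def serverOpt (encrypt key : Ident) : AsmProgram :=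
  [(key, .var keyVar), (encrypt, .func ⟨intPtrVoidSg, encryptCode⟩)]

/-- The global definitions of the server. -/
def serverSkel (encrypt key : Ident) : Skeleton :=
  [(key, .var keyVar), (encrypt, .func ())]

inductive SpecState where
  | Calle (i : BitVec 32) (vf : Val) (m : Mem)
  | Callp (sp : ℕ) (vf : Val) (m : Mem)
  | Retp (sp : ℕ) (m : Mem)
  | Rete (m : Mem)

inductive SpecInitial (encrypt : Ident) (se : SymTbl) : CQuery → SpecState → Prop
  | intro (be : ℕ) (i : BitVec 32) (vf : Val) (m : Mem) (he : se.symb encrypt = some be) :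
      SpecInitial encrypt se ⟨.Vptr be 0, intPtrVoidSg, [.Vint i, vf], m⟩ (.Calle i vf m)

inductive SpecStep (key : Ident) (se : SymTbl) : SpecState → Trace → SpecState → Prop
  | encrypt (i k : BitVec 32) (vf : Val) (m m' m'' : Mem) (bk sp : ℕ)
      (hk : se.symb key = some bk) (hl : m.load .Mint32 bk 0 = some (.Vint k))
      (ha : m.alloc 0 8 = (m', sp)) (hs : m'.store .Mint32 sp 0 (.Vint (i ^^^ k)) = some m'') :
      SpecStep key se (.Calle i vf m) [] (.Callp sp vf m'')
  | free (sp : ℕ) (m m' : Mem) (hf : m.free sp 0 8 = some m') :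
      SpecStep key se (.Retp sp m) [] (.Rete m')

inductive SpecExternal (sk : Skeleton) (se : SymTbl) : SpecState → CQuery → Prop
  | intro (sp bp : ℕ) (m : Mem) (hp : sk.IsExternal se (.Vptr bp 0)) :
      SpecExternal sk se (.Callp sp (.Vptr bp 0) m) ⟨.Vptr bp 0, ptrVoidSg, [.Vptr sp 0], m⟩

inductive SpecAfter : SpecState → CReply → SpecState → Prop
  | intro (sp : ℕ) (vf res : Val) (m m' : Mem) :
      SpecAfter (.Callp sp vf m) ⟨res, m'⟩ (.Retp sp m')

inductive SpecFinal : SpecState → CReply → Prop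
  | intro (m : Mem) : SpecFinal (.Rete m) ⟨.Vundef, m⟩

/-- The open LTS of the specification of the server. -/
def specLTS (encrypt key : Ident) (se : SymTbl) : LTS liC liC where
  State := SpecState
  valid (q : CQuery) := (serverSkel encrypt key).IsInternal se q.vf
  initial q s := SpecInitial encrypt se q s ∧ (serverSkel encrypt key).IsInternal se q.vf
  step := SpecStep key se
  final := SpecFinal
  external := SpecExternal (serverSkel encrypt key) se
  after := SpecAfter
  initial_valid _ _ h := h.2

/-- The specification `L_S` of the server. -/
def specSem (encrypt key : Ident) : OpenSem liC liC where
  skel := serverSkel encrypt key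
  activate := specLTS encrypt key

end CompCertO

/-!
The simulation is split at the intermediate symbol table of the last composition of the direct
convention: the specification is simulated by the server under `ro · wt · CAinjp`
(`specSem_serverOpt`), the server simulates itself under `asm_injp` (`asmSem_self`), and open
simulations compose (`OpenSim.trans`). The composite convention differs from the direct one in the
bracketing only, and rebracketing preserves simulations (`OpenSim.of_refines`).

*Self-simulation.* It holds for every assembly module, in lockstep: the memories and registers of
the two runs stay injected at a world accessible from the initial one, because each instruction
preserves injections (`execInstr_inject`). The stack-pointer test that decides whether control has
left the module agrees on both sides, because blocks that become mapped after the entry are new on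
both sides (`innerSp_inject`).

*Specification and server.* The constant `key` is not writable and has its initial value, so the
load of the specification yields the literal 42 of the code (`RoValid.load_key`). The 8-byte block
of the specification is mapped to the cells 8 to 15 of the 24-byte frame of the server
(`FrameInv`). The remaining cells of the frame hold the stack pointer and the return address of the
caller; no source cell reaches them, so that `injp` protects them during the callback
(`FrameInv.call`), and the server restores the registers of its caller from them
(`star_to_return`). Freeing the frame is not a step along `injp` accessibility from the world of
the callback, since those cells are out of reach; but it only concerns blocks that did not exist on
entry, so the final world is accessible from the initial one (`InjpWorld.Acc.of_sameBelow`).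
-/

namespace CompCertO

/-! ### Values and their encoding in memory cells -/

theorem BitVec.add_ofInt_assoc (o d : BitVec 64) (δ : ℤ) :
    o + BitVec.ofInt 64 δ + d = o + d + BitVec.ofInt 64 δ := by
  rw [BitVec.add_assoc, BitVec.add_comm (BitVec.ofInt 64 δ), ← BitVec.add_assoc]

theorem Val.Inject.mono {j j' : MemInj} (hj : j.Incl j') {v v' : Val} (h : Val.Inject j v v') :
    Val.Inject j' v v' := by
  cases h with
  | ptr b₁ b₂ o₁ δ h => exact .ptr _ _ _ _ (hj _ _ h)
  | _ => constructor

theorem MemVal.Inject.mono {j j' : MemInj} (hj : j.Incl j') {v v' : MemVal}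
    (h : MemVal.Inject j v v') : MemVal.Inject j' v v' := by
  cases h with
  | frag _ _ _ _ h => exact .frag _ _ _ _ (h.mono hj)
  | _ => constructor

theorem Val.Inject.ne_undef {j : MemInj} {v v' : Val} (h : Val.Inject j v v')
    (hv : v ≠ .Vundef) : v' ≠ .Vundef := by
  cases h <;> first | exact absurd rfl hv | exact Val.noConfusion

/-- A defined value has at most one image under an injection. -/
theorem Val.Inject.unique {j : MemInj} {v v' v'' : Val} (h : Val.Inject j v v')
    (h' : Val.Inject j v v'') (hv : v ≠ .Vundef) : v' = v'' := by
  cases h with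
  | undef => exact absurd rfl hv
  | ptr b₁ b₂ o₁ δ h =>
    cases h' with
    | ptr _ b₃ _ δ' h' =>
      rw [h] at h'
      cases h'
      rfl
  | _ => cases h'; rfl

theorem Val.Inject.offsetPtr {j : MemInj} {v v' : Val} (h : Val.Inject j v v') (d : Ptrofs) :
    Val.Inject j (v.offsetPtr d) (v'.offsetPtr d) := by
  cases h with
  | ptr b₁ b₂ o₁ δ h =>
    simp only [Val.offsetPtr, BitVec.add_ofInt_assoc]
    exact .ptr _ _ _ _ h
  | _ => exact .undef _

theorem Val.Inject.addl {j : MemInj} {v v' u u' : Val} (h : Val.Inject j v v')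
    (h' : Val.Inject j u u') : Val.Inject j (v.addl u) (v'.addl u') := by
  cases h with
  | long n =>
    cases h' with
    | long => exact .long _
    | ptr b₁ b₂ o₁ δ h =>
      simp only [Val.addl, BitVec.add_ofInt_assoc]
      exact .ptr _ _ _ _ h
    | _ => exact .undef _
  | ptr b₁ b₂ o₁ δ h =>
    cases h' with
    | long =>
      simp only [Val.addl, BitVec.add_ofInt_assoc]
      exact .ptr _ _ _ _ h
    | _ => exact .undef _
  | _ => exact .undef _

theorem Val.Inject.mull {j : MemInj} {v v' u u' : Val} (h : Val.Inject j v v')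
    (h' : Val.Inject j u u') : Val.Inject j (v.mull u) (v'.mull u') := by
  cases h with
  | long n =>
    cases h' with
    | long => exact .long _
    | _ => exact .undef _
  | _ => exact .undef _

theorem Val.Inject.xor {j : MemInj} {v v' u u' : Val} (h : Val.Inject j v v')
    (h' : Val.Inject j u u') : Val.Inject j (v.xor u) (v'.xor u') := by
  cases h with
  | int n =>
    cases h' with
    | int => exact .int _
    | _ => exact .undef _
  | _ => exact .undef _

theorem encodeInt_length (k x : ℕ) : (encodeInt k x).length = k := by
  induction k generalizing x with
  | zero => rfl
  | succ k ih => simp [encodeInt, ih]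

theorem decodeInt_encodeInt (k x : ℕ) : decodeInt (encodeInt k x) = x % 256 ^ k := by
  induction k generalizing x with
  | zero => simp [encodeInt, decodeInt, Nat.mod_one]
  | succ k ih =>
    simp only [encodeInt, decodeInt, ih, BitVec.toNat_ofNat]
    exact (Nat.mod_mul.symm).trans (by rw [pow_succ' 256 k])

theorem injValueRec_length (n : ℕ) (v : Val) (q : Quantity) : (injValueRec n v q).length = n := by
  induction n with
  | zero => rfl
  | succ n ih => simp [injValueRec, ih]

theorem encodeVal_length (c : Chunk) (v : Val) : (encodeVal c v).length = c.size := by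
  cases c <;> cases v <;>
    simp [encodeVal, injBytes, encodeInt_length, Chunk.size, injValue, injValueRec_length,
      Quantity.size]

theorem projBytes_injBytes (l : List (BitVec 8)) : projBytes (injBytes l) = some l := by
  induction l with
  | nil => rfl
  | cons b l ih =>
    simp only [injBytes, List.map_cons, projBytes] at ih ⊢
    rw [ih]
    rfl

/-- Reading back a stored 64-bit word. -/
theorem decodeVal_encodeVal_Mint64 (v : Val) (hv : v.HasType .Tlong) :
    decodeVal .Mint64 (encodeVal .Mint64 v) = v := by
  cases v with
  | Vlong n =>
    simp only [decodeVal, encodeVal, projBytes_injBytes, decodeInt_encodeInt]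
    congr 1
    apply BitVec.eq_of_toNat_eq
    simpa using n.isLt
  | Vptr b o =>
    simp [decodeVal, encodeVal, injValue, Quantity.size, injValueRec, projBytes, projValue,
      loadResult]
  | Vundef =>
    simp [decodeVal, encodeVal, projBytes, projValue, loadResult, Chunk.size, List.replicate]
  | _ => exact hv.elim

theorem forall₂_inject_injBytes (j : MemInj) (l : List (BitVec 8)) :
    List.Forall₂ (MemVal.Inject j) (injBytes l) (injBytes l) := by
  induction l with
  | nil => exact .nil
  | cons b l ih => exact .cons (.byte b) ih

theorem forall₂_inject_replicate_undef (j : MemInj) (n : ℕ) (l : List MemVal)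
    (hl : l.length = n) : List.Forall₂ (MemVal.Inject j) (List.replicate n .Undef) l := by
  induction n generalizing l with
  | zero => rw [List.length_eq_zero_iff.1 hl]; exact .nil
  | succ n ih =>
    cases l with
    | nil => simp at hl
    | cons a l => exact .cons (.undef a) (ih l (by simpa using hl))

theorem forall₂_inject_injValueRec {j : MemInj} {v v' : Val} (h : Val.Inject j v v')
    (q : Quantity) (n : ℕ) :
    List.Forall₂ (MemVal.Inject j) (injValueRec n v q) (injValueRec n v' q) := by
  induction n with
  | zero => exact .nil
  | succ n ih => exact .cons (.frag _ _ _ _ h) ih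

theorem Val.Inject.encodeVal {j : MemInj} {v v' : Val} (h : Val.Inject j v v') (c : Chunk) :
    List.Forall₂ (MemVal.Inject j) (encodeVal c v) (encodeVal c v') := by
  have hu : ∀ u w, CompCertO.encodeVal c u = List.replicate c.size .Undef →
      List.Forall₂ (MemVal.Inject j) (CompCertO.encodeVal c u) (CompCertO.encodeVal c w) := by
    intro u w hu
    rw [hu]
    exact forall₂_inject_replicate_undef j _ _ (encodeVal_length c w)
  cases c with
  | Many32 => exact forall₂_inject_injValueRec h _ _
  | Many64 => exact forall₂_inject_injValueRec h _ _
  | _ =>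
    cases h with
    | ptr b₁ b₂ o₁ δ h =>
      first
        | exact hu _ _ rfl
        | exact forall₂_inject_injValueRec (.ptr _ _ _ _ h) _ _
    | _ => first | exact hu _ _ rfl | exact forall₂_inject_injBytes j _

theorem projBytes_of_inject {j : MemInj} {l l' : List MemVal}
    (h : List.Forall₂ (MemVal.Inject j) l l') {bl : List (BitVec 8)}
    (hl : projBytes l = some bl) : projBytes l' = some bl := by
  induction h generalizing bl with
  | nil => exact hl
  | cons ha _ ih =>
    cases ha with
    | byte b =>
      simp only [projBytes, Option.map_eq_some_iff] at hl ⊢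
      obtain ⟨bl', h', rfl⟩ := hl
      exact ⟨bl', ih h', rfl⟩
    | _ => simp [projBytes] at hl

theorem eq_injValueRec_of_inject {j : MemInj} {v v' : Val} (h : Val.Inject j v v')
    (hv : v ≠ .Vundef) (q : Quantity) (n : ℕ) {l : List MemVal}
    (hl : List.Forall₂ (MemVal.Inject j) (injValueRec n v q) l) : l = injValueRec n v' q := by
  induction n generalizing l with
  | zero => cases hl; rfl
  | succ n ih =>
    cases hl with
    | cons ha hl =>
      cases ha with
      | frag _ _ _ _ hf => rw [ih hl, hf.unique h hv]; rfl

/-- A value read from fragments is either undefined, or all the cells are the fragments of it. -/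
theorem projValue_eq (q : Quantity) (l : List MemVal) :
    projValue q l = .Vundef ∨ l = injValue q (projValue q l) := by
  unfold projValue
  split
  · split_ifs with h
    · exact .inr h
    · exact .inl rfl
  · exact .inl rfl

/-- The fragments of an opaque value never decode to a number. -/
theorem projBytes_injValue (q : Quantity) (v : Val) : projBytes (injValue q v) = none := by
  cases q <;> rfl

theorem projValue_injValue (q : Quantity) (v : Val) : projValue q (injValue q v) = v := by
  cases q <;> simp [injValue, Quantity.size, injValueRec, projValue]

theorem loadResult_inject {j : MemInj} {v v' : Val} (h : Val.Inject j v v') (c : Chunk) :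
    Val.Inject j (loadResult c v) (loadResult c v') := by
  cases c <;> cases h <;> first | exact .undef _ | (constructor; done) | (constructor; assumption)

theorem decodeVal_inject {j : MemInj} {l l' : List MemVal}
    (h : List.Forall₂ (MemVal.Inject j) l l') :
    Val.Inject j (decodeVal .Mint64 l) (decodeVal .Mint64 l') := by
  rcases hl : projBytes l with _ | bl
  · have hd : decodeVal .Mint64 l = loadResult .Mint64 (projValue .Q64 l) := by
      simp [decodeVal, hl]
    rw [hd]
    rcases projValue_eq .Q64 l with hu | hu
    · rw [hu]; exact .undef _
    by_cases hv : projValue .Q64 l = .Vundef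
    · rw [hv]; exact .undef _
    generalize projValue .Q64 l = v at hu hv
    subst hu
    have hx : ∃ v', Val.Inject j v v' := by
      cases h with
      | cons ha _ => cases ha with
        | frag _ v' _ _ hf => exact ⟨v', hf⟩
    obtain ⟨v', hv'⟩ := hx
    have hl' : l' = injValue .Q64 v' := eq_injValueRec_of_inject hv' hv _ _ h
    have : decodeVal .Mint64 l' = loadResult .Mint64 v' := by
      simp [decodeVal, hl', projBytes_injValue, projValue_injValue]
    rw [this]
    exact loadResult_inject hv' _
  · simp only [decodeVal, hl, projBytes_of_inject h hl]
    exact .long _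

/-! ### Memory operations -/

namespace Mem

theorem Perm.mono {m : Mem} {b : ℕ} {o : ℤ} {k : PermKind} {p q : Permission}
    (h : m.Perm b o k p) (hq : q.rank ≤ p.rank) : m.Perm b o k q :=
  let ⟨r, hr, hp⟩ := h
  ⟨r, hr, hq.trans hp⟩

theorem Perm.cur_max {m : Mem} {b : ℕ} {o : ℤ} {p : Permission} (h : m.Perm b o .Cur p) :
    m.Perm b o .Max p :=
  let ⟨_, hr, hp⟩ := h
  let ⟨s, hs, hrs⟩ := m.access_max _ _ _ hr
  ⟨s, hs, hp.trans hrs⟩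

theorem Perm.nonempty {m : Mem} {b : ℕ} {o : ℤ} {k : PermKind} {p : Permission}
    (h : m.Perm b o k p) : m.Perm b o .Max .Nonempty := by
  cases k with
  | Max => exact h.mono (Nat.zero_le _)
  | Cur => exact h.cur_max.mono (Nat.zero_le _)

theorem Perm.valid {m : Mem} {b : ℕ} {o : ℤ} {k : PermKind} {p : Permission}
    (h : m.Perm b o k p) : m.Valid b := by
  obtain ⟨q, hq, _⟩ := h
  by_contra hb
  rw [m.noaccess b o k (not_lt.1 hb)] at hq
  cases hq

theorem getN_length (m : Mem) (b n : ℕ) (o : ℤ) : (m.getN b n o).length = n := by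
  induction n generalizing o with
  | zero => rfl
  | succ n ih => simp [getN, ih]

theorem getN_getElem? (m : Mem) (b n : ℕ) (o : ℤ) (i : ℕ) (hi : i < n) :
    (m.getN b n o)[i]? = some (m.contents b (o + i)) := by
  induction n generalizing o i with
  | zero => omega
  | succ n ih =>
    cases i with
    | zero => simp [getN]
    | succ i =>
      rw [getN, List.getElem?_cons_succ, ih _ _ (by omega)]
      congr 2
      push_cast
      ring

theorem getN_eq_of_getElem? {m : Mem} {b : ℕ} {o : ℤ} {l : List MemVal} {n : ℕ}
    (hn : l.length = n)
    (h : ∀ (i : ℕ) mv, l[i]? = some mv → m.contents b (o + i) = mv) : m.getN b n o = l := by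
  apply List.ext_getElem?
  intro i
  by_cases hi : i < n
  · rw [getN_getElem? _ _ _ _ _ hi]
    have hi' : i < l.length := by omega
    rw [List.getElem?_eq_getElem hi', h i _ (List.getElem?_eq_getElem hi')]
  · rw [List.getElem?_eq_none (by rw [getN_length]; omega), List.getElem?_eq_none (by omega)]

theorem getN_congr {m m' : Mem} {b : ℕ} {o : ℤ} {n : ℕ}
    (h : ∀ o', o ≤ o' → o' < o + n → m'.contents b o' = m.contents b o') :
    m'.getN b n o = m.getN b n o := by
  refine getN_eq_of_getElem? (getN_length _ _ _ _) fun i mv hi => ?_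
  have hin : i < n := by
    rw [← getN_length m b n o]
    exact (List.getElem?_eq_some_iff.1 hi).1
  rw [getN_getElem? _ _ _ _ _ hin] at hi
  rw [h _ (by omega) (by omega)]
  exact Option.some.inj hi

theorem getN_inject {j : MemInj} {m₁ m₂ : Mem} {b₁ b₂ : ℕ} {n : ℕ} {o₁ o₂ : ℤ}
    (h : ∀ i : ℕ, i < n → MemVal.Inject j (m₁.contents b₁ (o₁ + i)) (m₂.contents b₂ (o₂ + i))) :
    List.Forall₂ (MemVal.Inject j) (m₁.getN b₁ n o₁) (m₂.getN b₂ n o₂) := by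
  induction n generalizing o₁ o₂ with
  | zero => exact .nil
  | succ n ih =>
    refine .cons (by simpa using h 0 (by omega)) (ih fun i hi => ?_)
    have := h (i + 1) (by omega)
    push_cast at this
    rwa [show o₁ + (i + 1 : ℤ) = o₁ + 1 + i by ring, show o₂ + (i + 1 : ℤ) = o₂ + 1 + i by ring]
      at this

theorem setN_contents_of_mem (m : Mem) (b : ℕ) (o o' : ℤ) (l : List MemVal) (h₁ : o ≤ o')
    (h₂ : o' < o + l.length) :
    (m.setN b o l).contents b o' = l.getD (o' - o).toNat .Undef := by
  simp only [setN]
  rw [if_pos ⟨trivial, h₁, h₂⟩]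

theorem setN_contents_of_not_mem (m : Mem) (b b' : ℕ) (o o' : ℤ) (l : List MemVal)
    (h : ¬ (b' = b ∧ o ≤ o' ∧ o' < o + l.length)) :
    (m.setN b o l).contents b' o' = m.contents b' o' := by
  simp only [setN]
  rw [if_neg h]

theorem getN_setN_same (m : Mem) (b : ℕ) (o : ℤ) (l : List MemVal) {n : ℕ} (hn : l.length = n) :
    (m.setN b o l).getN b n o = l := by
  refine getN_eq_of_getElem? hn fun i mv hi => ?_
  have hil := (List.getElem?_eq_some_iff.1 hi).1
  rw [setN_contents_of_mem _ _ _ _ _ (by omega) (by omega)]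
  simp [List.getD, hi]

theorem getN_setN_other (m : Mem) (b : ℕ) (o o' : ℤ) (l : List MemVal) {n : ℕ}
    (h : o' + n ≤ o ∨ o + l.length ≤ o') : (m.setN b o l).getN b n o' = m.getN b n o' :=
  getN_congr fun x hx hx' => setN_contents_of_not_mem _ _ _ _ _ _ (by omega)

theorem store_eq_some {c : Chunk} {m m' : Mem} {b : ℕ} {o : ℤ} {v : Val} :
    m.store c b o v = some m' ↔
      m.ValidAccess c b o .Writable ∧ m.setN b o (encodeVal c v) = m' := by
  unfold store
  split_ifs with h <;> simp [h]

theorem load_eq_some {c : Chunk} {m : Mem} {b : ℕ} {o : ℤ} {v : Val} :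
    m.load c b o = some v ↔
      m.ValidAccess c b o .Readable ∧ decodeVal c (m.getN b c.size o) = v := by
  unfold load
  split_ifs with h <;> simp [h]

theorem setN_perm {m : Mem} {b b' : ℕ} {o o' : ℤ} {l : List MemVal} {k : PermKind}
    {p : Permission} : (m.setN b o l).Perm b' o' k p ↔ m.Perm b' o' k p := Iff.rfl

theorem alloc_perm_new {m : Mem} {lo hi o : ℤ} {k : PermKind} {p : Permission} :
    (m.alloc lo hi).1.Perm m.nextblock o k p ↔ lo ≤ o ∧ o < hi := by
  constructor
  · rintro ⟨q, hq, _⟩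
    simp only [alloc, if_true] at hq
    by_contra h
    rw [if_neg h] at hq
    cases hq
  · intro h
    refine ⟨.Freeable, ?_, by cases p <;> decide⟩
    simp only [alloc, if_true]
    rw [if_pos h]

theorem alloc_perm_old {m : Mem} {lo hi o : ℤ} {b : ℕ} (hb : b ≠ m.nextblock) {k : PermKind}
    {p : Permission} : (m.alloc lo hi).1.Perm b o k p ↔ m.Perm b o k p := by
  simp only [Perm, alloc, if_neg hb]

theorem alloc_contents_old {m : Mem} {lo hi : ℤ} {b : ℕ} (hb : b ≠ m.nextblock) :
    (m.alloc lo hi).1.contents b = m.contents b := by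
  funext o
  simp only [alloc, if_neg hb]

theorem alloc_contents_new {m : Mem} {lo hi o : ℤ} :
    (m.alloc lo hi).1.contents m.nextblock o = .Undef := by
  simp only [alloc, if_true]

/-- The effect of a successful `free`: the cells of the range lose all permissions, and nothing
else changes. -/
structure FreeSpec (m : Mem) (b : ℕ) (lo hi : ℤ) (m' : Mem) : Prop where
  range : m.RangePerm b lo hi .Cur .Freeable
  contents : m'.contents = m.contents
  nextblock : m'.nextblock = m.nextblock
  access : ∀ b', b' ≠ b → m'.access b' = m.access b'
  perm : ∀ b' o k p, m'.Perm b' o k p ↔ m.Perm b' o k p ∧ ¬ (b' = b ∧ lo ≤ o ∧ o < hi)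

theorem free_spec {m m' : Mem} {b : ℕ} {lo hi : ℤ} (h : m.free b lo hi = some m') :
    FreeSpec m b lo hi m' := by
  unfold free at h
  split_ifs at h with hr
  cases h
  refine ⟨hr, rfl, rfl, fun b' hb => ?_, fun b' o k p => ?_⟩
  · funext o k
    simp [hb]
  · simp only [Perm]
    by_cases hb : b' = b ∧ lo ≤ o ∧ o < hi
    · simp [hb]
    · simp [hb]

theorem free_of_range {m : Mem} {b : ℕ} {lo hi : ℤ} (h : m.RangePerm b lo hi .Cur .Freeable) :
    ∃ m', m.free b lo hi = some m' := by
  unfold free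
  rw [if_pos h]
  exact ⟨_, rfl⟩

/-- `m'` has at least the blocks of `m`, and agrees with `m` on the blocks below `n`. -/
structure SameBelow (n : ℕ) (m m' : Mem) : Prop where
  nextblock : m.nextblock ≤ m'.nextblock
  access : ∀ b < n, m'.access b = m.access b
  contents : ∀ b < n, m'.contents b = m.contents b

namespace SameBelow

variable {n : ℕ} {m m' m'' : Mem}

theorem refl (n : ℕ) (m : Mem) : SameBelow n m m := ⟨le_rfl, fun _ _ => rfl, fun _ _ => rfl⟩

theorem trans (h : SameBelow n m m') (h' : SameBelow n m' m'') : SameBelow n m m'' :=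
  ⟨h.nextblock.trans h'.nextblock, fun b hb => (h'.access b hb).trans (h.access b hb),
    fun b hb => (h'.contents b hb).trans (h.contents b hb)⟩

theorem perm (h : SameBelow n m m') {b : ℕ} (hb : b < n) {o : ℤ} {k : PermKind}
    {p : Permission} : m'.Perm b o k p ↔ m.Perm b o k p := by
  simp only [Perm, h.access b hb]

theorem setN (m : Mem) {b : ℕ} (hb : n ≤ b) (o : ℤ) (l : List MemVal) :
    SameBelow n m (m.setN b o l) := by
  refine ⟨le_rfl, fun _ _ => rfl, fun b' hb' => ?_⟩
  funext o'
  exact setN_contents_of_not_mem _ _ _ _ _ _ (by omega)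

theorem alloc (m : Mem) (lo hi : ℤ) : SameBelow m.nextblock m (m.alloc lo hi).1 := by
  refine ⟨Nat.le_succ _, fun b hb => ?_, fun b hb => alloc_contents_old hb.ne⟩
  funext o k
  simp only [Mem.alloc, if_neg hb.ne]

theorem of_freeSpec {b : ℕ} {lo hi : ℤ} (h : FreeSpec m b lo hi m') (hb : n ≤ b) :
    SameBelow n m m' :=
  ⟨h.nextblock.ge, fun b' hb' => h.access b' (by omega), fun b' _ => by rw [h.contents]⟩

end SameBelow

end Mem

/-! ### Memory operations under injections -/

/-- The injection `j` with the block `b` sent to `x`. -/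
def MemInj.extend (j : MemInj) (b : ℕ) (x : ℕ × ℤ) : MemInj :=
  fun b' => if b' = b then some x else j b'

namespace MemInj

variable {j : MemInj} {b : ℕ} {x : ℕ × ℤ}

theorem extend_self : j.extend b x b = some x := if_pos rfl

theorem extend_of_ne {b' : ℕ} (h : b' ≠ b) : j.extend b x b' = j b' := if_neg h

theorem extend_cases {b' : ℕ} {y : ℕ × ℤ} (h : j.extend b x b' = some y) :
    b' = b ∧ x = y ∨ b' ≠ b ∧ j b' = some y := by
  by_cases hb : b' = b
  · subst hb
    rw [extend_self] at h
    exact .inl ⟨rfl, Option.some.inj h⟩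
  · rw [extend_of_ne hb] at h
    exact .inr ⟨hb, h⟩

theorem incl_extend (h : j b = none) : j.Incl (j.extend b x) := by
  intro b' y hy
  rw [extend_of_ne, hy]
  rintro rfl
  rw [h] at hy
  cases hy

end MemInj

namespace Mem.Inject

variable {j : MemInj} {m₁ m₂ : Mem}

theorem valid_src (h : Mem.Inject j m₁ m₂) {b : ℕ} {x : ℕ × ℤ} (hb : j b = some x) :
    m₁.Valid b := by
  by_contra hv
  rw [h.freeblocks b hv] at hb
  cases hb

/-- The offset of an injected pointer does not wrap around, if the source cell is not empty. -/
theorem unsigned_add (h : Mem.Inject j m₁ m₂) {b₁ b₂ : ℕ} {δ : ℤ} {o : Ptrofs}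
    (hb : j b₁ = some (b₂, δ)) (hp : m₁.Perm b₁ (Ptrofs.unsigned o) .Max .Nonempty) :
    Ptrofs.unsigned (o + BitVec.ofInt 64 δ) = Ptrofs.unsigned o + δ := by
  obtain ⟨h₁, h₂⟩ := h.representable b₁ b₂ δ o hb (.inl hp)
  simp only [Ptrofs.unsigned] at h₂ ⊢
  rw [BitVec.toNat_add, BitVec.toNat_ofInt]
  push_cast
  rw [Int.toNat_of_nonneg (Int.emod_nonneg _ (by norm_num)), Int.add_emod_emod]
  exact Int.emod_eq_of_lt (by positivity) (by simpa using h₂)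

theorem validAccess (h : Mem.Inject j m₁ m₂) {b₁ b₂ : ℕ} {δ o : ℤ} {c : Chunk} {p : Permission}
    (hb : j b₁ = some (b₂, δ)) (ha : m₁.ValidAccess c b₁ o p) :
    m₂.ValidAccess c b₂ (o + δ) p := by
  refine ⟨fun x hx hx' => ?_, ?_⟩
  · have := h.perm b₁ b₂ δ (x - δ) .Cur p hb (ha.1 (x - δ) (by omega) (by omega))
    rwa [sub_add_cancel] at this
  · exact dvd_add ha.2
      (h.align b₁ b₂ δ o p c hb fun x hx hx' => (ha.1 x hx hx').cur_max)

theorem loadv (h : Mem.Inject j m₁ m₂) {a a' v : Val} (ha : Val.Inject j a a')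
    (hl : m₁.loadv .Mint64 a = some v) :
    ∃ v', m₂.loadv .Mint64 a' = some v' ∧ Val.Inject j v v' := by
  cases ha with
  | ptr b₁ b₂ o δ hb =>
    simp only [Mem.loadv, load_eq_some] at hl ⊢
    obtain ⟨hv, rfl⟩ := hl
    have hc : (0 : ℤ) < Chunk.size .Mint64 := by decide
    rw [h.unsigned_add hb (hv.1 _ le_rfl (by omega)).nonempty]
    refine ⟨_, ⟨h.validAccess hb hv, rfl⟩, decodeVal_inject (getN_inject fun i hi => ?_)⟩
    have := h.memval b₁ b₂ δ _ hb (hv.1 (Ptrofs.unsigned o + i) (by omega) (by omega))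
    rwa [add_right_comm] at this
  | _ => simp [Mem.loadv] at hl

/-- Writing related cells at related places. -/
theorem setN (h : Mem.Inject j m₁ m₂) {b₁ b₂ : ℕ} {δ o : ℤ} {l l' : List MemVal}
    (hb : j b₁ = some (b₂, δ)) (hl : List.Forall₂ (MemVal.Inject j) l l')
    (hr : m₁.RangePerm b₁ o (o + l.length) .Cur .Writable) :
    Mem.Inject j (m₁.setN b₁ o l) (m₂.setN b₂ (o + δ) l') := by
  have hlen := hl.length_eq
  refine ⟨h.perm, h.align, ?_, h.freeblocks, h.mappedblocks, h.no_overlap, h.representable,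
    h.perm_inv⟩
  intro b b' d x hj hp
  rw [setN_perm] at hp
  by_cases hx : b = b₁ ∧ o ≤ x ∧ x < o + l.length
  · obtain ⟨rfl, h₁, h₂⟩ := hx
    rw [hb] at hj
    cases hj
    rw [setN_contents_of_mem _ _ _ _ _ h₁ h₂,
      setN_contents_of_mem _ _ _ _ _ (by omega) (by omega), add_sub_add_right_eq_sub]
    have hi : (x - o).toNat < l.length := by omega
    rw [List.getD_eq_getElem _ _ hi, List.getD_eq_getElem _ _ (hlen ▸ hi)]
    exact hl.get hi (hlen ▸ hi)
  · rw [setN_contents_of_not_mem _ _ _ _ _ _ hx, setN_contents_of_not_mem]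
    · exact h.memval b b' d x hj hp
    · rintro ⟨rfl, h₁, h₂⟩
      by_cases hbb : b = b₁
      · subst hbb
        rw [hb] at hj
        cases hj
        exact hx ⟨rfl, by omega, by omega⟩
      · have hw := hr (x + d - δ) (by omega) (by omega)
        rcases h.no_overlap b _ d x b₁ _ δ (x + d - δ) hbb hj hb hp.nonempty hw.nonempty with h | h
        · exact h rfl
        · exact h (by omega)

/-- Writing in the target at places that no cell of the source reaches. -/
theorem setN_outOfReach (h : Mem.Inject j m₁ m₂) {b₂ : ℕ} {o : ℤ} {l : List MemVal}
    (hr : ∀ x, o ≤ x → x < o + l.length → j.OutOfReach m₁ b₂ x) :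
    Mem.Inject j m₁ (m₂.setN b₂ o l) := by
  refine ⟨h.perm, h.align, ?_, h.freeblocks, h.mappedblocks, h.no_overlap, h.representable,
    h.perm_inv⟩
  intro b b' d x hj hp
  rw [setN_contents_of_not_mem]
  · exact h.memval b b' d x hj hp
  · rintro ⟨rfl, h₁, h₂⟩
    refine hr (x + d) h₁ h₂ b d hj ?_
    rw [add_sub_cancel_right]
    exact hp.nonempty

/-- Allocating a block on both sides, where the target block contains a copy of the source
block at the offset `δ`. The alignment of every chunk divides 8. Offsets within the copy do not wrap
around if they stay below `2 ^ 64`; for `δ = 0` no bound on the size is needed. -/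
theorem alloc (h : Mem.Inject j m₁ m₂) {lo hi lo' hi' δ : ℤ} (hlo : lo' ≤ lo + δ)
    (hhi : hi + δ ≤ hi') (hδ : 8 ∣ δ) (hrep : δ = 0 ∨ 0 ≤ δ ∧ hi + δ < 2 ^ 64) :
    Mem.Inject (j.extend m₁.nextblock (m₂.nextblock, δ)) (m₁.alloc lo hi).1
      (m₂.alloc lo' hi').1 := by
  have hfree : j m₁.nextblock = none := h.freeblocks _ (lt_irrefl _)
  have hne : ∀ {b x}, j b = some x → b ≠ m₁.nextblock := by
    rintro b x hb rfl
    rw [hfree] at hb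
    cases hb
  have hne' : ∀ {b b' d}, j b = some (b', d) → b' ≠ m₂.nextblock := fun hb =>
    (h.mappedblocks _ _ _ hb).ne
  refine ⟨?_, ?_, ?_, ?_, ?_, ?_, ?_, ?_⟩
  · intro b b' d o k p hj hp
    rcases MemInj.extend_cases hj with ⟨rfl, hx⟩ | ⟨hb, hj⟩
    · cases hx
      rw [alloc_perm_new] at hp ⊢
      omega
    · rw [alloc_perm_old hb] at hp
      rw [alloc_perm_old (hne' hj)]
      exact h.perm _ _ _ _ _ _ hj hp
  · intro b b' d o p c hj hp
    rcases MemInj.extend_cases hj with ⟨rfl, hx⟩ | ⟨hb, hj⟩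
    · cases hx
      refine dvd_trans ?_ hδ
      cases c <;> simp only [Chunk.align] <;> norm_num
    · exact h.align b b' d o p c hj fun x hx hx' => (alloc_perm_old hb).1 (hp x hx hx')
  · intro b b' d o hj hp
    rcases MemInj.extend_cases hj with ⟨rfl, hx⟩ | ⟨hb, hj⟩
    · rw [alloc_contents_new]
      exact .undef _
    · rw [alloc_contents_old hb, alloc_contents_old (hne' hj)]
      exact (h.memval _ _ _ _ hj ((alloc_perm_old hb).1 hp)).mono (MemInj.incl_extend hfree)
  · intro b hb
    have hb' : m₁.nextblock < b := by
      have : ¬ b < m₁.nextblock + 1 := hb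
      omega
    rw [MemInj.extend_of_ne hb'.ne']
    exact h.freeblocks b (not_lt.2 hb'.le)
  · intro b b' d hj
    rcases MemInj.extend_cases hj with ⟨rfl, hx⟩ | ⟨hb, hj⟩
    · cases hx
      exact Nat.lt_succ_self _
    · exact Nat.lt_succ_of_lt (h.mappedblocks _ _ _ hj)
  · intro b₁ b₂ d o b₁' b₂' d' o' hbb hj hj' hp hp'
    rcases MemInj.extend_cases hj with ⟨rfl, hx⟩ | ⟨hb, hj⟩
    · rcases MemInj.extend_cases hj' with ⟨rfl, hx'⟩ | ⟨hb', hj'⟩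
      · exact absurd rfl hbb
      · cases hx
        exact .inl (hne' hj').symm
    · rcases MemInj.extend_cases hj' with ⟨rfl, hx'⟩ | ⟨hb', hj'⟩
      · cases hx'
        exact .inl (hne' hj)
      · exact h.no_overlap _ _ _ _ _ _ _ _ hbb hj hj' ((alloc_perm_old hb).1 hp)
          ((alloc_perm_old hb').1 hp')
  · intro b b' d o hj hp
    rcases MemInj.extend_cases hj with ⟨rfl, hx⟩ | ⟨hb, hj⟩
    · cases hx
      rw [alloc_perm_new, alloc_perm_new] at hp
      have ho : Ptrofs.unsigned o < 2 ^ 64 := by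
        have := o.isLt
        simp only [Ptrofs.unsigned]
        exact_mod_cast this
      rcases hrep with rfl | hrep
      · exact ⟨le_rfl, by simpa using ho⟩
      · exact ⟨hrep.1, by omega⟩
    · rw [alloc_perm_old hb, alloc_perm_old hb] at hp
      exact h.representable _ _ _ _ hj hp
  · intro b b' d o k p hj hp
    rcases MemInj.extend_cases hj with ⟨rfl, hx⟩ | ⟨hb, hj⟩
    · rw [alloc_perm_new, alloc_perm_new]
      exact em _
    · rw [alloc_perm_old (hne' hj)] at hp
      rw [alloc_perm_old hb, alloc_perm_old hb]
      exact h.perm_inv _ _ _ _ _ _ hj hp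

/-- Freeing on both sides, where no cell that survives in the source is mapped to a cell that is
freed in the target. -/
theorem free (h : Mem.Inject j m₁ m₂) {b₁ b₂ : ℕ} {lo hi lo' hi' : ℤ} {m₁' m₂' : Mem}
    (hf₁ : FreeSpec m₁ b₁ lo hi m₁') (hf₂ : FreeSpec m₂ b₂ lo' hi' m₂')
    (hsurv : ∀ b d o, j b = some (b₂, d) → lo' ≤ o + d → o + d < hi' →
      ¬ m₁'.Perm b o .Max .Nonempty) :
    Mem.Inject j m₁' m₂' := by
  have hv₁ : ∀ b, m₁'.Valid b ↔ m₁.Valid b := fun b => by simp only [Mem.Valid, hf₁.nextblock]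
  have hv₂ : ∀ b, m₂'.Valid b ↔ m₂.Valid b := fun b => by simp only [Mem.Valid, hf₂.nextblock]
  have hle : ∀ {b o k p}, m₁'.Perm b o k p → m₁.Perm b o k p := fun hp =>
    ((hf₁.perm _ _ _ _).1 hp).1
  refine ⟨?_, ?_, ?_, ?_, ?_, ?_, ?_, ?_⟩
  · intro b b' d o k p hj hp
    refine (hf₂.perm _ _ _ _).2 ⟨h.perm _ _ _ _ _ _ hj (hle hp), ?_⟩
    rintro ⟨rfl, h₁, h₂⟩
    exact hsurv _ _ _ hj h₁ h₂ hp.nonempty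
  · exact fun b b' d o p c hj hp => h.align b b' d o p c hj fun x hx hx' => hle (hp x hx hx')
  · intro b b' d o hj hp
    rw [hf₁.contents, hf₂.contents]
    exact h.memval _ _ _ _ hj (hle hp)
  · exact fun b hb => h.freeblocks b fun hb' => hb ((hv₁ b).2 hb')
  · exact fun b b' d hj => (hv₂ b').2 (h.mappedblocks _ _ _ hj)
  · exact fun b₁ b₂ d o b₁' b₂' d' o' hbb hj hj' hp hp' =>
      h.no_overlap _ _ _ _ _ _ _ _ hbb hj hj' (hle hp) (hle hp')
  · exact fun b b' d o hj hp => h.representable _ _ _ _ hj (hp.imp hle hle)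
  · intro b b' d o k p hj hp
    by_cases hn : b = b₁ ∧ lo ≤ o ∧ o < hi
    · exact .inr fun hp' => ((hf₁.perm _ _ _ _).1 hp').2 hn
    · rcases h.perm_inv _ _ _ _ _ _ hj ((hf₂.perm _ _ _ _).1 hp).1 with hp' | hp'
      · exact .inl ((hf₁.perm _ _ _ _).2 ⟨hp', hn⟩)
      · exact .inr fun hp'' => hp' (hle hp'')

end Mem.Inject

/-! ### Accessibility of `injp` worlds -/

theorem Mem.Acc.refl (m : Mem) : m.Acc m :=
  ⟨fun _ h => h, fun _ _ _ _ h => h, fun _ _ _ _ h => ⟨rfl, h⟩⟩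

theorem Mem.Acc.trans {m m' m'' : Mem} (h : m.Acc m') (h' : m'.Acc m'') : m.Acc m'' where
  valid b hb := h'.valid b (h.valid b hb)
  max_perm b o p hb hp := h.max_perm b o p hb (h'.max_perm b o p (h.valid b hb) hp)
  ro b o hb hw hr := by
    obtain ⟨h₁, h₂⟩ := h'.ro b o (h.valid b hb) (fun hw' => hw (h.max_perm b o _ hb hw')) hr
    obtain ⟨h₃, h₄⟩ := h.ro b o hb hw h₂
    exact ⟨h₃.trans h₁, h₄⟩

theorem Mem.Acc.of_sameBelow {m m' m'' : Mem} (h : m.Acc m')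
    (hs : SameBelow m.nextblock m' m'') : m.Acc m'' where
  valid b hb := lt_of_lt_of_le (h.valid b hb) hs.nextblock
  max_perm b o p hb hp := h.max_perm b o p hb ((hs.perm hb).1 hp)
  ro b o hb hw hr := by
    rw [hs.contents b hb]
    exact h.ro b o hb hw ((hs.perm hb).1 hr)

theorem Mem.UnchangedOn.of_sameBelow {P : ℕ → ℤ → Prop} {m m' m'' : Mem}
    (h : m.UnchangedOn P m') (hs : SameBelow m.nextblock m' m'') : m.UnchangedOn P m'' where
  perm b o k p hP hb := (h.perm b o k p hP hb).trans (hs.perm hb).symm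
  contents b o hP hp := by
    rw [hs.contents b hp.valid]
    exact h.contents b o hP hp

namespace InjpWorld

theorem Acc.refl (w : InjpWorld) : w.Acc w where
  incr _ _ h := h
  unmapped := ⟨fun _ _ _ _ _ _ => Iff.rfl, fun _ _ _ _ => rfl⟩
  outOfReach := ⟨fun _ _ _ _ _ _ => Iff.rfl, fun _ _ _ _ => rfl⟩
  accSrc := .refl _
  accTgt := .refl _
  separated b₁ b₂ δ h h' := by
    rw [h] at h'
    cases h'

theorem Acc.trans {w w' w'' : InjpWorld} (hw : Mem.Inject w.inj w.src w.tgt) (h : w.Acc w')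
    (h' : w'.Acc w'') : w.Acc w'' := by
  -- blocks of `w` that `w` does not map, and cells of `w` that it does not reach, remain so at `w'`
  have hu : ∀ b o, w.inj.Unmapped b o → w.src.Valid b → w'.inj.Unmapped b o := by
    intro b o hb hv
    rcases hx : w'.inj b with _ | ⟨b', δ⟩
    · exact hx
    · exact absurd hv (h.separated b b' δ hb hx).1
  have ho : ∀ b o, w.inj.OutOfReach w.src b o → w.tgt.Valid b →
      w'.inj.OutOfReach w'.src b o := by
    intro b o hb hv b₁ δ hj hp
    rcases hx : w.inj b₁ with _ | ⟨b', δ'⟩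
    · exact (h.separated _ _ _ hx hj).2 hv
    · have := h.incr _ _ hx
      rw [hj] at this
      cases this
      exact hb b₁ δ hx (h.accSrc.max_perm _ _ _ (hw.valid_src hx) hp)
  refine ⟨fun b x hb => h'.incr b x (h.incr b x hb), ⟨?_, ?_⟩, ⟨?_, ?_⟩, h.accSrc.trans h'.accSrc,
    h.accTgt.trans h'.accTgt, ?_⟩
  · intro b o k p hb hv
    exact (h.unmapped.perm b o k p hb hv).trans
      (h'.unmapped.perm b o k p (hu b o hb hv) (h.accSrc.valid b hv))
  · intro b o hb hp
    rw [h'.unmapped.contents b o (hu b o hb hp.valid)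
      ((h.unmapped.perm b o _ _ hb hp.valid).1 hp), h.unmapped.contents b o hb hp]
  · intro b o k p hb hv
    exact (h.outOfReach.perm b o k p hb hv).trans
      (h'.outOfReach.perm b o k p (ho b o hb hv) (h.accTgt.valid b hv))
  · intro b o hb hp
    rw [h'.outOfReach.contents b o (ho b o hb hp.valid)
      ((h.outOfReach.perm b o _ _ hb hp.valid).1 hp), h.outOfReach.contents b o hb hp]
  · intro b₁ b₂ δ hn hj
    rcases hx : w'.inj b₁ with _ | ⟨b', δ'⟩
    · obtain ⟨h₁, h₂⟩ := h'.separated _ _ _ hx hj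
      exact ⟨fun hv => h₁ (h.accSrc.valid _ hv), fun hv => h₂ (h.accTgt.valid _ hv)⟩
    · have := h'.incr _ _ hx
      rw [hj] at this
      cases this
      exact h.separated _ _ _ hn hx

/-- Changes of blocks that did not exist at `w` do not affect accessibility from `w`. -/
theorem Acc.of_sameBelow {w w' w'' : InjpWorld} (h : w.Acc w') (hi : w.inj.Incl w''.inj)
    (hsep : InjSeparated w.inj w''.inj w.src w.tgt)
    (hs : Mem.SameBelow w.src.nextblock w'.src w''.src)
    (ht : Mem.SameBelow w.tgt.nextblock w'.tgt w''.tgt) : w.Acc w'' :=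
  ⟨hi, h.unmapped.of_sameBelow hs, h.outOfReach.of_sameBelow ht, h.accSrc.of_sameBelow hs,
    h.accTgt.of_sameBelow ht, hsep⟩

theorem separated_extend {j : MemInj} {m₁ m₂ : Mem} {b₁ b₂ : ℕ} {δ : ℤ} (h₁ : ¬ m₁.Valid b₁)
    (h₂ : ¬ m₂.Valid b₂) : InjSeparated j (j.extend b₁ (b₂, δ)) m₁ m₂ := by
  intro b b' d hn hj
  rcases MemInj.extend_cases hj with ⟨rfl, hx⟩ | ⟨hb, hj⟩
  · cases hx
    exact ⟨h₁, h₂⟩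
  · rw [hn] at hj
    cases hj

theorem Acc.setN {j : MemInj} {m₁ m₂ : Mem} (h : Mem.Inject j m₁ m₂) {b₁ b₂ : ℕ} {δ o : ℤ}
    {l l' : List MemVal} (hb : j b₁ = some (b₂, δ)) (hlen : l.length = l'.length)
    (hr : m₁.RangePerm b₁ o (o + l.length) .Cur .Writable) :
    Acc ⟨j, m₁, m₂⟩ ⟨j, m₁.setN b₁ o l, m₂.setN b₂ (o + δ) l'⟩ := by
  have key : ∀ (m : Mem) (b : ℕ) (x : ℤ) (k : List MemVal),
      m.RangePerm b x (x + k.length) .Cur .Writable → m.Acc (m.setN b x k) := by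
    intro m b x k hk
    refine ⟨fun _ hv => hv, fun _ _ _ _ hp => hp, fun b' x' _ hw hp => ⟨?_, hp⟩⟩
    rw [Mem.setN_contents_of_not_mem]
    rintro ⟨rfl, h₁, h₂⟩
    exact hw (hk x' h₁ h₂).cur_max
  have hr₂ : m₂.RangePerm b₂ (o + δ) (o + δ + l'.length) .Cur .Writable := by
    intro x hx hx'
    have := h.perm b₁ b₂ δ (x - δ) .Cur .Writable hb (hr (x - δ) (by omega) (by omega))
    rwa [sub_add_cancel] at this
  refine ⟨fun _ _ hx => hx, ⟨fun _ _ _ _ _ _ => Iff.rfl, ?_⟩, ⟨fun _ _ _ _ _ _ => Iff.rfl, ?_⟩,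
    key _ _ _ _ hr, key _ _ _ _ hr₂, (Acc.refl ⟨j, m₁, m₂⟩).separated⟩
  · intro b x hx _
    refine Mem.setN_contents_of_not_mem _ _ _ _ _ _ ?_
    rintro ⟨rfl, _⟩
    simp only [MemInj.Unmapped, hb, reduceCtorEq] at hx
  · intro b x hx _
    refine Mem.setN_contents_of_not_mem _ _ _ _ _ _ ?_
    rintro ⟨rfl, h₁, h₂⟩
    exact hx b₁ δ hb (hr (x - δ) (by omega) (by omega)).nonempty

theorem Acc.free {j : MemInj} {m₁ m₂ m₁' m₂' : Mem} {b₁ b₂ : ℕ} {δ lo hi lo' hi' : ℤ}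
    (hb : j b₁ = some (b₂, δ)) (hf₁ : Mem.FreeSpec m₁ b₁ lo hi m₁')
    (hf₂ : Mem.FreeSpec m₂ b₂ lo' hi' m₂')
    (hlo : ∀ o, lo' ≤ o + δ → o + δ < hi' → lo ≤ o ∧ o < hi) :
    Acc ⟨j, m₁, m₂⟩ ⟨j, m₁', m₂'⟩ := by
  have key : ∀ {m m' : Mem} {b : ℕ} {x y : ℤ}, Mem.FreeSpec m b x y m' → m.Acc m' := by
    intro m m' b x y hf
    refine ⟨fun b' hv => ?_, fun b' _ _ _ hp => ((hf.perm _ _ _ _).1 hp).1,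
      fun b' x' _ hw hp => ⟨by rw [hf.contents], ((hf.perm _ _ _ _).1 hp).1⟩⟩
    simpa only [Mem.Valid, hf.nextblock] using hv
  refine ⟨fun _ _ hx => hx, ⟨?_, ?_⟩, ⟨?_, ?_⟩, key hf₁, key hf₂,
    (Acc.refl ⟨j, m₁, m₂⟩).separated⟩
  · intro b x k p hx _
    rw [hf₁.perm]
    refine (and_iff_left ?_).symm
    rintro ⟨rfl, _⟩
    simp only [MemInj.Unmapped, hb, reduceCtorEq] at hx
  · intro b x _ _
    rw [hf₁.contents]
  · intro b x k p hx _
    rw [hf₂.perm]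
    refine (and_iff_left ?_).symm
    rintro ⟨rfl, h₁, h₂⟩
    obtain ⟨h₃, h₄⟩ := hlo (x - δ) (by omega) (by omega)
    exact hx b₁ δ hb (hf₁.range (x - δ) h₃ h₄).nonempty
  · intro b x _ _
    rw [hf₂.contents]

/-! ### Symbol tables at related worlds -/

theorem MatchSenv.acc {w w' : InjpWorld} {se₁ se₂ : SymTbl} (h : w.MatchSenv se₁ se₂)
    (hacc : w.Acc w') : w'.MatchSenv se₁ se₂ := by
  -- a mapping of `w'` is one of `w`, or it relates blocks that are in neither symbol table
  have hc : ∀ {b₁ b₂ δ}, w'.inj b₁ = some (b₂, δ) →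
      w.inj b₁ = some (b₂, δ) ∨ ¬ b₁ < se₁.next ∧ ¬ b₂ < se₂.next := by
    intro b₁ b₂ δ hj
    rcases hx : w.inj b₁ with _ | ⟨b', δ'⟩
    · obtain ⟨h₁, h₂⟩ := hacc.separated _ _ _ hx hj
      exact .inr ⟨fun hb => h₁ (lt_of_lt_of_le hb h.src), fun hb => h₂ (lt_of_lt_of_le hb h.tgt)⟩
    · have := hacc.incr _ _ hx
      rw [hj] at this
      cases this
      exact .inl rfl
  have hle : ∀ {m m' : Mem}, m.Acc m' → m.nextblock ≤ m'.nextblock := by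
    intro m m' hm
    by_contra hlt
    exact lt_irrefl _ (hm.valid m'.nextblock (not_le.1 hlt))
  refine ⟨⟨?_, ?_, ?_, ?_, ?_⟩, h.src.trans (hle hacc.accSrc), h.tgt.trans (hle hacc.accTgt)⟩
  · intro b₁ hb
    obtain ⟨b₂, hj⟩ := h.stbls.dom b₁ hb
    exact ⟨b₂, hacc.incr _ _ hj⟩
  · intro b₂ hb
    obtain ⟨b₁, hj⟩ := h.stbls.img b₂ hb
    exact ⟨b₁, hacc.incr _ _ hj⟩
  · intro b₁ b₂ δ hj id
    rcases hc hj with hj | ⟨h₁, h₂⟩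
    · exact h.stbls.symb _ _ _ hj id
    · exact ⟨fun hs => absurd (se₁.symb_range _ _ hs) h₁,
        fun hs => absurd (se₂.symb_range _ _ hs) h₂⟩
  · intro b₁ b₂ δ hj
    rcases hc hj with hj | ⟨h₁, h₂⟩
    · exact h.stbls.info _ _ _ hj
    · rcases hi : se₁.info b₁ with _ | g
      · rcases hi' : se₂.info b₂ with _ | g
        · rfl
        · exact absurd (se₂.info_range _ _ hi') h₂
      · exact absurd (se₁.info_range _ _ hi) h₁
  · intro b₁ b₂ δ hj
    rcases hc hj with hj | ⟨h₁, h₂⟩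
    · exact h.stbls.separated _ _ _ hj
    · exact iff_of_false h₁ h₂

end InjpWorld

namespace SymTbl.Match

variable {j : MemInj} {se₁ se₂ : SymTbl}

/-- Blocks of the symbol table are mapped without an offset. -/
theorem delta_eq_zero (h : SymTbl.Match j se₁ se₂) {b₁ b₂ : ℕ} {δ : ℤ}
    (hj : j b₁ = some (b₂, δ)) (hb : b₁ < se₁.next) : δ = 0 := by
  obtain ⟨b, hb⟩ := h.dom b₁ hb
  rw [hj] at hb
  cases hb
  rfl

theorem symb_some (h : SymTbl.Match j se₁ se₂) {id : Ident} {b₁ : ℕ}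
    (hs : se₁.symb id = some b₁) : ∃ b₂, j b₁ = some (b₂, 0) ∧ se₂.symb id = some b₂ := by
  obtain ⟨b₂, hj⟩ := h.dom b₁ (se₁.symb_range _ _ hs)
  exact ⟨b₂, hj, (h.symb _ _ _ hj id).1 hs⟩

theorem validFor (h : SymTbl.Match j se₁ se₂) {sk : Skeleton} (hv : se₁.ValidFor sk) :
    se₂.ValidFor sk := by
  intro id g hg
  obtain ⟨b, g', hb, hi, hl⟩ := hv id g hg
  obtain ⟨b₂, hj, hs⟩ := h.symb_some hb
  exact ⟨b₂, g', hs, (h.info _ _ _ hj) ▸ hi, hl⟩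

theorem functAt (h : SymTbl.Match j se₁ se₂) {F : Type} {p : Program F} {b₁ b₂ : ℕ} {f : F}
    {δ : ℤ} (hj : j b₁ = some (b₂, δ)) : p.FunctAt se₁ b₁ f ↔ p.FunctAt se₂ b₂ f := by
  simp only [Program.FunctAt, h.symb _ _ _ hj]

theorem isInternal_iff (h : SymTbl.Match j se₁ se₂) {F : Type} (p : Program F) {v v' : Val}
    (hv : Val.Inject j v v') (hd : v ≠ .Vundef) : p.IsInternal se₁ v ↔ p.IsInternal se₂ v' := by
  cases hv with
  | undef => exact absurd rfl hd
  | ptr b₁ b₂ o δ hj =>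
    constructor
    · rintro ⟨b, f, hb, id, hs, hf⟩
      cases hb
      have := h.delta_eq_zero hj (se₁.symb_range _ _ hs)
      subst this
      exact ⟨b₂, f, by simp, id, (h.symb _ _ _ hj id).1 hs, hf⟩
    · rintro ⟨b, f, hb, id, hs, hf⟩
      rw [Val.Vptr.injEq] at hb
      obtain ⟨rfl, ho⟩ := hb
      have hs₁ := (h.symb _ _ _ hj id).2 hs
      have := h.delta_eq_zero hj (se₁.symb_range _ _ hs₁)
      subst this
      exact ⟨b₁, f, by simpa using ho, id, hs₁, hf⟩
  | _ => constructor <;> (rintro ⟨b, f, hb, _⟩; cases hb)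

theorem isExternal (h : SymTbl.Match j se₁ se₂) {F : Type} {p : Program F} {v v' : Val}
    (hv : Val.Inject j v v') (he : p.IsExternal se₁ v) : p.IsExternal se₂ v' := by
  obtain ⟨b, rfl, hi, hs⟩ := he
  cases hv with
  | ptr _ b₂ _ δ hj =>
    have := h.delta_eq_zero hj (se₁.info_range _ _ hi)
    subst this
    refine ⟨b₂, by simp, (h.info _ _ _ hj) ▸ hi, fun id hs₂ => hs id ((h.symb _ _ _ hj id).2 hs₂)⟩

end SymTbl.Match

/-! ### Assembly modules simulate themselves -/

/-- Register sets related by an injection. -/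
def RegSet.Inject (j : MemInj) (rs rs' : RegSet) : Prop := ∀ r, Val.Inject j (rs r) (rs' r)

namespace RegSet.Inject

variable {j : MemInj} {rs rs' : RegSet}

theorem mono {j' : MemInj} (hj : j.Incl j') (h : RegSet.Inject j rs rs') :
    RegSet.Inject j' rs rs' := fun r => (h r).mono hj

theorem set (h : RegSet.Inject j rs rs') (r : PReg) {v v' : Val} (hv : Val.Inject j v v') :
    RegSet.Inject j (rs.set r v) (rs'.set r v') := by
  intro r'
  unfold RegSet.set
  split_ifs
  · exact hv
  · exact h r'

theorem nextInstr (h : RegSet.Inject j rs rs') :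
    RegSet.Inject j (nextInstr rs) (nextInstr rs') := h.set _ ((h _).offsetPtr 1)

theorem nextInstrNf (h : RegSet.Inject j rs rs') :
    RegSet.Inject j (nextInstrNf rs) (nextInstrNf rs') := by
  refine RegSet.Inject.nextInstr fun r => ?_
  cases r with
  | CR => exact .undef _
  | _ => exact h _

theorem evalAddrMode (h : RegSet.Inject j rs rs') {se₁ se₂ : SymTbl}
    (hse : SymTbl.Match j se₁ se₂) (a : AddrMode) :
    Val.Inject j (evalAddrMode se₁ a rs) (evalAddrMode se₂ a rs') := by
  refine .addl ?_ (.addl ?_ ?_)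
  · cases a.base with
    | none => exact .long _
    | some r => exact h _
  · rcases a.index with _ | ⟨r, sc⟩
    · exact .long _
    · dsimp only
      split_ifs
      · exact h _
      · exact (h _).mull (.long _)
  · rcases a.const with n | ⟨id, ofs⟩
    · exact .long _
    · dsimp only
      rcases hs : se₁.symb id with _ | b₁
      · exact .undef _
      · obtain ⟨b₂, hj, hs₂⟩ := hse.symb_some hs
        simpa [hs₂] using Val.Inject.ptr b₁ b₂ ofs 0 hj

end RegSet.Inject

theorem Mem.Inject.storev {j : MemInj} {m₁ m₂ m₁' : Mem} (h : Mem.Inject j m₁ m₂)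
    {a a' v v' : Val} {c : Chunk} (ha : Val.Inject j a a') (hv : Val.Inject j v v')
    (hs : m₁.storev c a v = some m₁') :
    ∃ m₂', m₂.storev c a' v' = some m₂' ∧ Mem.Inject j m₁' m₂' ∧
      InjpWorld.Acc ⟨j, m₁, m₂⟩ ⟨j, m₁', m₂'⟩ := by
  cases ha with
  | ptr b₁ b₂ o δ hb =>
    simp only [Mem.storev, Mem.store_eq_some] at hs ⊢
    obtain ⟨hacc, rfl⟩ := hs
    have hc : (0 : ℤ) < c.size := by cases c <;> decide
    rw [h.unsigned_add hb (hacc.1 _ le_rfl (by omega)).nonempty]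
    have hr : m₁.RangePerm b₁ (Ptrofs.unsigned o)
        (Ptrofs.unsigned o + (CompCertO.encodeVal c v).length) .Cur .Writable := by
      rw [encodeVal_length]
      exact hacc.1
    exact ⟨_, ⟨h.validAccess hb hacc, rfl⟩, h.setN hb (hv.encodeVal c) hr,
      .setN h hb (hv.encodeVal c).length_eq hr⟩
  | _ => simp [Mem.storev] at hs

/-- The invariant of the self-simulation: the memories and the registers are injected at a world
that is accessible from the initial one. -/
def AsmMatch (w : InjpWorld) (s₁ s₂ : AsmInternal) : Prop :=
  Mem.Inject w.inj w.src w.tgt ∧ s₁.nb = w.src.nextblock ∧ s₂.nb = w.tgt.nextblock ∧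
    s₁.live = s₂.live ∧
    ∃ j, w.Acc ⟨j, s₁.mem, s₂.mem⟩ ∧ Mem.Inject j s₁.mem s₂.mem ∧ RegSet.Inject j s₁.rs s₂.rs

/-- Injected stack pointers agree on whether they designate a frame of the module: blocks that were
not mapped when the module was entered are new on both sides. -/
theorem innerSp_inject {w w' : InjpWorld} (hw : Mem.Inject w.inj w.src w.tgt) (hacc : w.Acc w')
    {v v' : Val} (hv : Val.Inject w'.inj v v') {live : Bool}
    (h : innerSp w.src.nextblock v = some live) : innerSp w.tgt.nextblock v' = some live := by
  cases hv with
  | ptr b₁ b₂ o δ hj =>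
    have hiff : b₁ < w.src.nextblock ↔ b₂ < w.tgt.nextblock := by
      rcases hx : w.inj b₁ with _ | ⟨b, d⟩
      · obtain ⟨h₁, h₂⟩ := hacc.separated _ _ _ hx hj
        exact iff_of_false h₁ h₂
      · have := hacc.incr _ _ hx
        rw [hj] at this
        cases this
        exact iff_of_true (hw.valid_src hx) (hw.mappedblocks _ _ _ hx)
    simpa only [innerSp, hiff] using h
  | _ => simp [innerSp] at h

/-- An instruction that runs in the source runs in the target with injected results. Only
`Pallocframe` extends the injection. -/
theorem execInstr_inject {w : InjpWorld} {j : MemInj} {m₁ m₂ m₁' : Mem} {rs₁ rs₂ rs₁' : RegSet}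
    {se₁ se₂ : SymTbl} {i : Instr} {live : Bool} (hw : Mem.Inject w.inj w.src w.tgt)
    (hacc : w.Acc ⟨j, m₁, m₂⟩) (hm : Mem.Inject j m₁ m₂) (hrs : RegSet.Inject j rs₁ rs₂)
    (hse : SymTbl.Match j se₁ se₂)
    (he : execInstr se₁ w.src.nextblock i rs₁ m₁ = some (rs₁', m₁', live)) :
    ∃ rs₂' m₂' j', execInstr se₂ w.tgt.nextblock i rs₂ m₂ = some (rs₂', m₂', live) ∧
      w.Acc ⟨j', m₁', m₂'⟩ ∧ Mem.Inject j' m₁' m₂' ∧ RegSet.Inject j' rs₁' rs₂' := by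
  cases i with
  | Pxorl_ri rd n =>
    simp only [execInstr, Option.some.injEq, Prod.mk.injEq] at he ⊢
    obtain ⟨rfl, rfl, rfl⟩ := he
    exact ⟨_, _, j, ⟨rfl, rfl, rfl⟩, hacc, hm, (hrs.set _ ((hrs _).xor (.int _))).nextInstrNf⟩
  | Pmovl_mr a r =>
    simp only [execInstr, Option.map_eq_some_iff, Prod.mk.injEq] at he ⊢
    obtain ⟨m, hs, rfl, rfl, rfl⟩ := he
    obtain ⟨m', hs', hm', hacc'⟩ := hm.storev (hrs.evalAddrMode hse a) (hrs _) hs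
    exact ⟨_, _, j, ⟨m', hs', rfl, rfl, rfl⟩, hacc.trans hw hacc', hm', hrs.nextInstrNf⟩
  | Pleaq rd a =>
    simp only [execInstr, Option.some.injEq, Prod.mk.injEq] at he ⊢
    obtain ⟨rfl, rfl, rfl⟩ := he
    exact ⟨_, _, j, ⟨rfl, rfl, rfl⟩, hacc, hm, (hrs.set _ (hrs.evalAddrMode hse a)).nextInstr⟩
  | Pcall_r r sg =>
    simp only [execInstr, Option.some.injEq, Prod.mk.injEq] at he ⊢
    obtain ⟨rfl, rfl, rfl⟩ := he
    exact ⟨_, _, j, ⟨rfl, rfl, rfl⟩, hacc, hm, (hrs.set _ ((hrs _).offsetPtr 1)).set _ (hrs _)⟩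
  | Pret =>
    simp only [execInstr, Option.map_eq_some_iff, Prod.mk.injEq] at he ⊢
    obtain ⟨l, hl, rfl, rfl, rfl⟩ := he
    exact ⟨_, _, j, ⟨l, innerSp_inject hw hacc (hrs _) hl, rfl, rfl, rfl⟩, hacc, hm,
      hrs.set _ (hrs _)⟩
  | Pallocframe sz ofs_ra ofs_link =>
    simp only [execInstr, Option.bind_eq_some_iff, Option.map_eq_some_iff, Prod.mk.injEq] at he ⊢
    obtain ⟨ma, hsa, mb, hsb, rfl, rfl, rfl⟩ := he
    have hinc : j.Incl (j.extend m₁.nextblock (m₂.nextblock, 0)) :=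
      MemInj.incl_extend (hm.freeblocks _ (lt_irrefl _))
    have hm' := hm.alloc (lo := 0) (hi := sz) (lo' := 0) (hi' := sz) (δ := 0) (by simp) (by simp)
      (by simp) (.inl rfl)
    have hacc' : InjpWorld.Acc ⟨j, m₁, m₂⟩
        ⟨j.extend m₁.nextblock (m₂.nextblock, 0), (m₁.alloc 0 sz).1, (m₂.alloc 0 sz).1⟩ :=
      (InjpWorld.Acc.refl ⟨j, m₁, m₂⟩).of_sameBelow hinc
        (InjpWorld.separated_extend (lt_irrefl _) (lt_irrefl _)) (.alloc _ _ _) (.alloc _ _ _)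
    have hsp : Val.Inject (j.extend m₁.nextblock (m₂.nextblock, 0))
        (.Vptr (m₁.alloc 0 sz).2 0) (.Vptr (m₂.alloc 0 sz).2 0) := by
      simpa [Mem.alloc] using
        Val.Inject.ptr m₁.nextblock m₂.nextblock 0 0 (MemInj.extend_self (j := j))
    have hrs' := hrs.mono hinc
    obtain ⟨ma', hsa', hma, hacca⟩ := hm'.storev (hsp.offsetPtr ofs_link) (hrs' _) hsa
    obtain ⟨mb', hsb', hmb, haccb⟩ := hma.storev (hsp.offsetPtr ofs_ra) (hrs' _) hsb
    exact ⟨_, _, _, ⟨ma', hsa', mb', hsb', rfl, rfl, rfl⟩,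
      ((hacc.trans hw hacc').trans hw hacca).trans hw haccb, hmb,
      ((hrs'.set _ (hrs' _)).set _ hsp).nextInstr⟩
  | Pfreeframe sz ofs_ra ofs_link =>
    simp only [execInstr, Option.bind_eq_some_iff] at he ⊢
    obtain ⟨ra, hra, sp, hsp, he⟩ := he
    obtain ⟨ra', hra', hrai⟩ := hm.loadv ((hrs _).offsetPtr ofs_ra) hra
    obtain ⟨sp', hsp', hspi⟩ := hm.loadv ((hrs _).offsetPtr ofs_link) hsp
    have hspr := hrs .SP
    generalize rs₁ .SP = v₁, rs₂ .SP = v₂ at *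
    cases hspr with
    | ptr b₁ b₂ o δ hj =>
      simp only [Option.map_eq_some_iff, Prod.mk.injEq] at he ⊢
      obtain ⟨mf, hf, rfl, rfl, rfl⟩ := he
      have hf₁ := Mem.free_spec hf
      -- an empty frame has no cell that would keep the target offset from wrapping around
      have hrange : ∀ x, Ptrofs.unsigned (o + BitVec.ofInt 64 δ) ≤ x + δ ∧
          x + δ < Ptrofs.unsigned (o + BitVec.ofInt 64 δ) + sz ↔
          Ptrofs.unsigned o ≤ x ∧ x < Ptrofs.unsigned o + sz := by
        intro x
        by_cases hsz : 0 < sz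
        · rw [hm.unsigned_add hj (hf₁.range _ le_rfl (by omega)).nonempty]
          omega
        · omega
      obtain ⟨mf', hf'⟩ := Mem.free_of_range (m := m₂) (b := b₂)
        (lo := Ptrofs.unsigned (o + BitVec.ofInt 64 δ))
        (hi := Ptrofs.unsigned (o + BitVec.ofInt 64 δ) + sz) (by
          intro x hx hx'
          have := (hrange (x - δ)).1 ⟨by omega, by omega⟩
          simpa using hm.perm _ _ _ _ _ _ hj (hf₁.range (x - δ) this.1 this.2))
      have hf₂ := Mem.free_spec hf'
      have haccf : InjpWorld.Acc ⟨j, m₁, m₂⟩ ⟨j, mf, mf'⟩ :=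
        .free hj hf₁ hf₂ fun x hx hx' => (hrange x).1 ⟨hx, hx'⟩
      refine ⟨_, _, j, ⟨ra', hra', sp', hsp', mf', hf', rfl, rfl, rfl⟩, hacc.trans hw haccf, ?_,
        ((hrs.set _ hspi).set _ hrai).nextInstr⟩
      refine hm.free hf₁ hf₂ fun b d x hb hx hx' hp => ?_
      obtain ⟨hp, hn⟩ := (hf₁.perm _ _ _ _).1 hp
      by_cases hbb : b = b₁
      · subst hbb
        rw [hj] at hb
        cases hb
        exact hn ⟨rfl, (hrange x).1 ⟨hx, hx'⟩⟩
      · obtain ⟨h₁, h₂⟩ := (hrange (x + d - δ)).1 ⟨by omega, by omega⟩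
        rcases hm.no_overlap b _ d x b₁ _ δ (x + d - δ) hbb hb hj hp
          (hf₁.range _ h₁ h₂).nonempty with h | h
        · exact h rfl
        · exact h (by omega)
    | _ => simp at he

/-- Every assembly module simulates itself under `asm_injp`. -/
theorem asmSem_self (p : AsmProgram) : OpenSim ccAsmInjp ccAsmInjp (asmSem p) (asmSem p) := by
  refine ⟨rfl, fun (w : InjpWorld) _ _ s₁ s₂ => AsmMatch w s₁ s₂, ?_⟩
  intro w se₁ se₂ hse _
  change InjpWorld at w
  change w.MatchSenv se₁ se₂ at hse
  refine ⟨?_, ?_, ?_, ?_, ?_⟩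
  · rintro q₁ q₂ ⟨_, hrs, hpc⟩
    exact hse.stbls.isInternal_iff p (hrs _) hpc
  · rintro ⟨rs₁, m₁⟩ ⟨rs₂, m₂⟩ s₁ ⟨⟨h₁, h₂, hm⟩, hrs, hpc⟩ ⟨hi, hsp, hra, rfl⟩
    subst h₁ h₂
    exact ⟨⟨_, _, _, true⟩, ⟨hm, rfl, rfl, rfl, w.inj, .refl _, hm, hrs⟩,
      (hse.stbls.isInternal_iff p (hrs _) hpc).1 hi, (hrs _).ne_undef hsp, (hrs _).ne_undef hra,
      rfl⟩
  · rintro _ ⟨nb₂, rs₂, m₂, live₂⟩ _ _ ⟨hw, h₁, h₂, h₃, j, hacc, hm, hrs⟩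
      ⟨nb, rs, rs', m, m', live, b, o, f, i, hpc, hf, hi, he⟩
    dsimp only at h₁ h₂ h₃ hacc hm hrs
    subst h₁ h₂ h₃
    have hse' := (hse.acc hacc).stbls
    obtain ⟨rs₂', m₂', j', he', hacc', hm', hrs'⟩ := execInstr_inject hw hacc hm hrs hse' he
    refine ⟨⟨_, rs₂', m₂', live⟩, ⟨hw, rfl, rfl, rfl, j', hacc', hm', hrs'⟩,
      .step _ _ _ [] [] ?_ (.refl _)⟩
    have hpc' := hrs .PC
    rw [hpc] at hpc'
    generalize hv : rs₂ .PC = v at hpc'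
    cases hpc' with
    | ptr _ b₂ _ δ hj =>
      -- blocks of functions are mapped without an offset, so both sides fetch the same instruction
      obtain ⟨id, hs, _⟩ := id hf
      have hδ := hse'.delta_eq_zero hj (se₁.symb_range _ _ hs)
      subst hδ
      exact .internal _ _ _ _ _ _ b₂ o f i (by simpa using hv) ((hse'.functAt hj).1 hf) hi he'
  · rintro ⟨nb₁, rs₁, m₁, live₁⟩ ⟨nb₂, rs₂, m₂, live₂⟩ _ ⟨hw, h₁, h₂, h₃, j, hacc, hm, hrs⟩
      ⟨hl, hext, rfl⟩
    dsimp only at h₁ h₂ h₃ hacc hm hrs hl hext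
    subst h₁ h₂ h₃ hl
    have hse' := hse.acc hacc
    have hext₂ := hse'.stbls.isExternal (hrs _) hext
    refine ⟨(⟨j, m₁, m₂⟩ : InjpWorld), ⟨rs₂, m₂⟩, hse', ⟨⟨rfl, rfl, hm⟩, hrs, ?_⟩,
      ⟨rfl, hext₂, rfl⟩, ?_⟩
    · obtain ⟨b, hb, _⟩ := hext
      change rs₁ .PC ≠ _
      rw [hb]
      exact Val.noConfusion
    · rintro ⟨rs₁', m₁'⟩ ⟨rs₂', m₂'⟩ _ ⟨w', hacc', ⟨h₁, h₂, hm'⟩, hrs'⟩ ⟨_, _, live, hin, rfl⟩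
      dsimp only at h₁ h₂ hm' hrs' hin
      subst h₁ h₂
      have hacc'' := hacc.trans hw hacc'
      exact ⟨⟨_, rs₂', _, live⟩, ⟨hw, rfl, rfl, rfl, w'.inj, hacc'', hm', hrs'⟩, rfl, hext₂, live,
        innerSp_inject hw hacc'' (hrs' _) hin, rfl⟩
  · rintro s₁ s₂ _ ⟨hw, h₁, h₂, h₃, j, hacc, hm, hrs⟩ ⟨hl, rfl⟩
    exact ⟨⟨s₂.rs, s₂.mem⟩, ⟨⟨j, s₁.mem, s₂.mem⟩, hacc, ⟨rfl, rfl, hm⟩, hrs⟩, h₃ ▸ hl, rfl⟩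

/-! ### Runs of the server -/

theorem Program.find_erase {F : Type} (p : Program F) (id : Ident) :
    p.erase.find id = (p.find id).map GlobDef.erase := by
  induction p with
  | nil => rfl
  | cons d p ih =>
    obtain ⟨id', g⟩ := d
    simp only [Program.find, Program.erase, List.map_cons, List.lookup_cons] at ih ⊢
    cases id == id' with
    | true => rfl
    | false => exact ih

theorem Program.isInternal_erase {F : Type} {p : Program F} {se : SymTbl} {v : Val} :
    p.erase.IsInternal se v ↔ p.IsInternal se v := by
  constructor
  · rintro ⟨b, f, rfl, id, hs, hf⟩
    rw [Program.find_erase, Option.map_eq_some_iff] at hf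
    obtain ⟨g, hg, hgf⟩ := hf
    cases g with
    | func f => exact ⟨b, f, rfl, id, hs, hg⟩
    | var v => cases hgf
  · rintro ⟨b, f, rfl, id, hs, hf⟩
    exact ⟨b, (), rfl, id, hs, by rw [Program.find_erase, hf]; rfl⟩

theorem Program.isExternal_erase {F : Type} {p : Program F} {se : SymTbl} {v : Val} :
    p.erase.IsExternal se v ↔ p.IsExternal se v := by
  simp only [Program.IsExternal, Program.find_erase, Option.map_eq_none_iff]

theorem find_serverOpt_encrypt {encrypt key : Ident} (hne : encrypt ≠ key) :
    (serverOpt encrypt key).find encrypt = some (.func ⟨intPtrVoidSg, encryptCode⟩) := by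
  simp [serverOpt, Program.find, List.lookup, beq_false_of_ne hne]

/-- In a memory with read-only constants intact, the constant `key` reads as 42; this is why the
target may use the literal instead. -/
theorem RoValid.load_key {encrypt key : Ident} {se : SymTbl} {m : Mem} (hro : RoValid se m)
    (hv : se.ValidFor (serverSkel encrypt key)) {bk : ℕ} (hk : se.symb key = some bk)
    {v : Val} (hl : m.load .Mint32 bk 0 = some v) : v = .Vint 42 := by
  obtain ⟨b, g, hb, hi, hlo⟩ := hv key (.var keyVar) (by
    simp [serverSkel, Program.find])
  rw [hk] at hb
  cases hb
  cases hlo with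
  | var _ v' hr hvo hini =>
    have hinit : v'.init = [.int32 42] := by
      generalize hx : keyVar.init = l at hini
      generalize v'.init = l' at hini
      cases hini with
      | refl => exact hx.symm
      | undefined => cases hx
      | common => cases hx
    have hc : v'.IsConst :=
      ⟨hr.symm, hvo.symm, by simp [hinit], by simp [hinit]⟩
    obtain ⟨hacc, rfl⟩ := Mem.load_eq_some.1 hl
    have hget : m.getN bk 4 0 = injBytes (encodeInt 4 42) := by
      refine Mem.getN_eq_of_getElem? (by simp [injBytes, encodeInt_length]) fun i mv hmv => ?_
      have hi4 : i < 4 := by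
        have := (List.getElem?_eq_some_iff.1 hmv).1
        simpa [injBytes, encodeInt_length] using this
      rw [zero_add]
      refine hro.values key bk v' hk hi hc i mv ?_ (hacc.1 _ (by omega) ?_)
      · simpa [hinit, InitData.bytes] using hmv
      · simp only [Chunk.size]
        push_cast
        omega
    change decodeVal .Mint32 (m.getN bk 4 0) = _
    simp [hget, decodeVal, projBytes_injBytes, decodeInt_encodeInt]

theorem Mem.storev_frame {m : Mem} {b : ℕ} {c : Chunk} {o : Ptrofs} {v : Val}
    (hm : m.RangePerm b 0 24 .Cur .Freeable) (ho : Ptrofs.unsigned o + c.size ≤ 24)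
    (hal : c.align ∣ Ptrofs.unsigned o) :
    m.storev c (.Vptr b o) v = some (m.setN b (Ptrofs.unsigned o) (encodeVal c v)) := by
  refine Mem.store_eq_some.2 ⟨⟨fun x hx hx' => ?_, hal⟩, rfl⟩
  have h0 : 0 ≤ Ptrofs.unsigned o := Int.natCast_nonneg _
  exact (hm x (by omega) (by omega)).mono (by decide)

/-- The memory in which the server calls the callback: a new frame of 24 bytes that holds the stack
pointer and the return address of the caller, and the encrypted number `n`. -/
noncomputable def frameMem (m : Mem) (sp ra : Val) (n : BitVec 32) : Mem :=
  (((m.alloc 0 24).1.setN m.nextblock 0 (encodeVal .Mint64 sp)).setN m.nextblock 16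
    (encodeVal .Mint64 ra)).setN m.nextblock 8 (encodeVal .Mint32 (.Vint n))

section Runs

variable {p : AsmProgram} {se : SymTbl} {b : ℕ} {sg : Signature}

/-- Prefix a run by the execution of one instruction. -/
theorem star_instr {f : AsmFunction} {nb : ℕ} {rs rs' : RegSet} {m m' : Mem} {live : Bool}
    {o : Ptrofs} {s : AsmInternal} (i : Instr) (hpc : rs .PC = .Vptr b o) (hf : p.FunctAt se b f)
    (hi : f.code[BitVec.toNat o]? = some i)
    (he : execInstr se nb i rs m = some (rs', m', live))
    (hs : (asmLTS p se).Star (⟨nb, rs', m', live⟩ : AsmInternal) [] s) :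
    (asmLTS p se).Star (⟨nb, rs, m, true⟩ : AsmInternal) [] s :=
  .step (L := asmLTS p se) _ _ _ [] [] (.internal _ _ _ _ _ _ b o f i hpc hf hi he) hs

/-- The run from the entry of `encrypt` to the call. -/
theorem star_to_call (hf : p.FunctAt se b ⟨sg, encryptCode⟩) (nb : ℕ) {rs : RegSet} (m : Mem)
    (hpc : rs .PC = .Vptr b 0) {n : BitVec 32} (hn : rs (.IR .RDI) = .Vint n) :
    ∃ rs', (asmLTS p se).Star ⟨nb, rs, m, true⟩ []
        ⟨nb, rs', frameMem m (rs .SP) (rs .RA) (n ^^^ 42), true⟩ ∧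
      rs' .PC = rs (.IR .RSI) ∧ rs' .SP = .Vptr m.nextblock 0 ∧ rs' .RA = .Vptr b 5 ∧
      rs' (.IR .RDI) = .Vptr m.nextblock 8 ∧ ∀ r ∈ calleeSaveRegs, rs' r = rs r := by
  set stk := m.nextblock with hstk
  have hrange : (m.alloc 0 24).1.RangePerm stk 0 24 .Cur .Freeable := fun x hx hx' =>
    Mem.alloc_perm_new.2 ⟨hx, hx'⟩
  obtain ⟨rs₁, h₁⟩ : ∃ x, x = nextInstr ((rs.set (.IR .RAX) (rs .SP)).set .SP (.Vptr stk 0)) :=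
    ⟨_, rfl⟩
  obtain ⟨rs₂, h₂⟩ : ∃ x, x = nextInstrNf (rs₁.set (.IR .RDI) (.Vint (n ^^^ 42))) := ⟨_, rfl⟩
  obtain ⟨rs₃, h₃⟩ : ∃ x, x = nextInstrNf rs₂ := ⟨_, rfl⟩
  obtain ⟨rs₄, h₄⟩ : ∃ x, x = nextInstr (rs₃.set (.IR .RDI) (.Vptr stk 8)) := ⟨_, rfl⟩
  have pc₁ : rs₁ .PC = .Vptr b 1 := by simp [h₁, nextInstr, RegSet.set, hpc, Val.offsetPtr]
  have pc₂ : rs₂ .PC = .Vptr b 2 := by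
    simp [h₂, nextInstrNf, nextInstr, RegSet.set, pc₁, Val.offsetPtr]
  have pc₃ : rs₃ .PC = .Vptr b 3 := by
    simp [h₃, nextInstrNf, nextInstr, RegSet.set, pc₂, Val.offsetPtr]
  have pc₄ : rs₄ .PC = .Vptr b 4 := by simp [h₄, nextInstr, RegSet.set, pc₃, Val.offsetPtr]
  have di₁ : rs₁ (.IR .RDI) = .Vint n := by simp [h₁, nextInstr, RegSet.set, hn]
  have di₂ : rs₂ (.IR .RDI) = .Vint (n ^^^ 42) := by
    simp [h₂, nextInstrNf, nextInstr, RegSet.set]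
  have di₄ : rs₄ (.IR .RDI) = .Vptr stk 8 := by simp [h₄, nextInstr, RegSet.set]
  have sp₁ : rs₁ .SP = .Vptr stk 0 := by simp [h₁, nextInstr, RegSet.set]
  have sp₂ : rs₂ .SP = .Vptr stk 0 := by simp [h₂, nextInstrNf, nextInstr, RegSet.set, sp₁]
  have sp₃ : rs₃ .SP = .Vptr stk 0 := by simp [h₃, nextInstrNf, nextInstr, RegSet.set, sp₂]
  have sp₄ : rs₄ .SP = .Vptr stk 0 := by simp [h₄, nextInstr, RegSet.set, sp₃]
  have other : ∀ r : IReg, r ≠ .RAX → r ≠ .RSP → r ≠ .RDI → rs₄ (.IR r) = rs (.IR r) := by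
    intro r ha hs hd
    simp [h₄, h₃, h₂, h₁, nextInstrNf, nextInstr, RegSet.set, ha, hs, hd]
  have addr : ∀ rs' : RegSet, rs' .SP = .Vptr stk 0 →
      evalAddrMode se slotAddr rs' = .Vptr stk 8 := by
    intro rs' h
    simp [evalAddrMode, slotAddr, Val.addl, h]
  refine ⟨(rs₄.set .RA (.Vptr b 5)).set .PC (rs (.IR .RSI)), ?_, by simp [RegSet.set],
    by simp [RegSet.set, sp₄], by simp [RegSet.set], by simp [RegSet.set, di₄], ?_⟩
  · set m₁ := ((m.alloc 0 24).1.setN stk 0 (encodeVal .Mint64 (rs .SP))).setN stk 16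
      (encodeVal .Mint64 (rs .RA)) with hm₁
    have e₁ : execInstr se nb (.Pallocframe 24 16 0) rs m = some (rs₁, m₁, true) := by
      simp only [execInstr, Option.bind_eq_some_iff, Option.map_eq_some_iff]
      exact ⟨_, Mem.storev_frame (b := stk) (o := 0) hrange (by decide) (by decide), _,
        Mem.storev_frame (b := stk) (o := 16) hrange (by decide) (by decide), by rw [h₁]; rfl⟩
    have e₂ : execInstr se nb (.Pxorl_ri .RDI 42) rs₁ m₁ = some (rs₂, m₁, true) := by
      simp only [execInstr, di₁, Val.xor, h₂]
    have e₃ : execInstr se nb (.Pmovl_mr slotAddr .RDI) rs₂ m₁ =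
        some (rs₃, frameMem m (rs .SP) (rs .RA) (n ^^^ 42), true) := by
      simp only [execInstr, di₂, addr rs₂ sp₂]
      rw [Mem.storev_frame (m := m₁) (b := stk) (o := 8) (c := .Mint32) hrange (by decide)
        (by decide), h₃]
      rfl
    have e₄ : execInstr se nb (.Pleaq .RDI slotAddr) rs₃
        (frameMem m (rs .SP) (rs .RA) (n ^^^ 42)) =
        some (rs₄, frameMem m (rs .SP) (rs .RA) (n ^^^ 42), true) := by
      simp only [execInstr, addr rs₃ sp₃, h₄]
    refine star_instr _ hpc hf rfl e₁ <| star_instr _ pc₁ hf rfl e₂ <|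
      star_instr _ pc₂ hf rfl e₃ <| star_instr _ pc₃ hf rfl e₄ <|
      star_instr (.Pcall_r .RSI ptrVoidSg) pc₄ hf rfl ?_ (.refl _)
    simp only [execInstr, pc₄, Val.offsetPtr, other .RSI (by simp) (by simp) (by simp)]
    rfl
  · intro r hr
    simp only [calleeSaveRegs, List.mem_cons, List.not_mem_nil, or_false] at hr
    rcases hr with rfl | rfl | rfl | rfl | rfl | rfl <;>
      simp [RegSet.set, other]

/-- The run from the return of the callback to the return of `encrypt`. -/
theorem star_to_return (hf : p.FunctAt se b ⟨sg, encryptCode⟩) {nb : ℕ} {rs : RegSet}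
    {m m' : Mem} {stk : ℕ} {sp ra : Val} (hpc : rs .PC = .Vptr b 5) (hsp : rs .SP = .Vptr stk 0)
    (hm : m.RangePerm stk 0 24 .Cur .Freeable)
    (hlink : m.getN stk 8 0 = encodeVal .Mint64 sp) (hra : m.getN stk 8 16 = encodeVal .Mint64 ra)
    (hspt : sp.HasType .Tlong) (hrat : ra.HasType .Tlong)
    (hin : innerSp nb sp = some false) (hfree : m.free stk 0 24 = some m') :
    ∃ rs', (asmLTS p se).Star ⟨nb, rs, m, true⟩ [] ⟨nb, rs', m', false⟩ ∧
      rs' .SP = sp ∧ rs' .PC = ra ∧ ∀ r ∈ calleeSaveRegs, rs' r = rs r := by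
  have hload : ∀ (o : Ptrofs) (v : Val), v.HasType .Tlong → Ptrofs.unsigned o + 8 ≤ 24 →
      8 ∣ Ptrofs.unsigned o → m.getN stk 8 (Ptrofs.unsigned o) = encodeVal .Mint64 v →
      m.loadv .Mptr (.Vptr stk o) = some v := by
    intro o v hv ho hal hg
    refine Mem.load_eq_some.2 ⟨⟨fun x hx hx' => ?_, hal⟩, ?_⟩
    · have h0 : 0 ≤ Ptrofs.unsigned o := Int.natCast_nonneg _
      have hx'' : x < Ptrofs.unsigned o + 8 := hx'
      exact (hm x (by omega) (by omega)).mono (by decide)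
    · change decodeVal .Mint64 (m.getN stk 8 _) = v
      rw [hg, decodeVal_encodeVal_Mint64 v hv]
  obtain ⟨rs₁, h₁⟩ : ∃ x, x = nextInstr ((rs.set .SP sp).set .RA ra) := ⟨_, rfl⟩
  have pc₁ : rs₁ .PC = .Vptr b 6 := by simp [h₁, nextInstr, RegSet.set, hpc, Val.offsetPtr]
  have sp₁ : rs₁ .SP = sp := by simp [h₁, nextInstr, RegSet.set]
  have ra₁ : rs₁ .RA = ra := by simp [h₁, nextInstr, RegSet.set]
  refine ⟨rs₁.set .PC ra, ?_, by simp [RegSet.set, sp₁], by simp [RegSet.set], ?_⟩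
  · have e₁ : execInstr se nb (.Pfreeframe 24 16 0) rs m = some (rs₁, m', true) := by
      have hl₁ := hload 16 ra hrat (by decide) (by decide) hra
      have hl₂ := hload 0 sp hspt (by decide) (by decide) hlink
      simp only [execInstr, hsp]
      change (m.loadv .Mptr (.Vptr stk 16)).bind (fun ra' =>
        (m.loadv .Mptr (.Vptr stk 0)).bind fun sp' => (m.free stk 0 24).map fun m'' =>
          (nextInstr ((rs.set .SP sp').set .RA ra'), m'', true)) = _
      rw [hl₁, hl₂, hfree, h₁]
      rfl
    refine star_instr _ hpc hf rfl e₁ <| star_instr .Pret pc₁ hf rfl ?_ (.refl _)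
    simp only [execInstr, sp₁, hin, ra₁]
    rfl
  · intro r hr
    simp only [calleeSaveRegs, List.mem_cons, List.not_mem_nil, or_false] at hr
    rcases hr with rfl | rfl | rfl | rfl | rfl | rfl <;>
      simp [RegSet.set, h₁, nextInstr]

end Runs

/-! ### The specification is simulated by the server -/

theorem RoValid.of_sameBelow {se : SymTbl} {m m' : Mem} (h : RoValid se m)
    (hs : Mem.SameBelow m.nextblock m m') : RoValid se m' := by
  have hlt : ∀ {id b}, se.symb id = some b → b < m.nextblock := fun hb =>
    (se.symb_range _ _ hb).trans_le h.next
  refine ⟨h.next.trans hs.nextblock, ?_, ?_⟩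
  · intro id b v hb hi hc n mv hn hp
    rw [hs.contents b (hlt hb)]
    exact h.values id b v hb hi hc n mv hn ((hs.perm (hlt hb)).1 hp)
  · intro id b v hb hi hc o hp
    exact h.nonwritable id b v hb hi hc o ((hs.perm (hlt hb)).1 hp)

/-- The facts about an incoming call that remain relevant until it returns; `b` is the block of
`encrypt` in the target. -/
structure ServerEntry (w : CAWorld) (p : AsmProgram) (se : SymTbl) (b : ℕ) : Prop where
  inject : Mem.Inject w.injp.inj w.injp.src w.injp.tgt
  functAt : p.FunctAt se b ⟨intPtrVoidSg, encryptCode⟩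
  outOfReach : ∀ b o, OutgoingArguments w.sg (w.rs .SP) b o →
    w.injp.inj.OutOfReach w.injp.src b o
  sp_valid : ∃ b o, w.rs .SP = .Vptr b o ∧ w.injp.tgt.Valid b
  ra_type : (w.rs .RA).HasType .Tptr

/-- The relation between the 8-byte block `sp` of the specification and the 24-byte frame `stk` of
the server: `sp` is mapped to the cells 8 to 15 of `stk`, no block is mapped to the other cells,
and these hold the stack pointer and the return address of the caller. -/
structure FrameInv (w : CAWorld) (sp stk : ℕ) (j : MemInj) (m₁ m₂ : Mem) : Prop where
  acc : w.injp.Acc ⟨j, m₁, m₂⟩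
  inject : Mem.Inject j m₁ m₂
  new_src : w.injp.src.nextblock ≤ sp
  new_tgt : w.injp.tgt.nextblock ≤ stk
  map : j sp = some (stk, 8)
  map_unique : ∀ b δ, j b = some (stk, δ) → b = sp
  perm_src : ∀ o, m₁.Perm sp o .Max .Nonempty → 0 ≤ o ∧ o < 8
  perm_tgt : ∀ o, 0 ≤ o ∧ o < 8 ∨ 16 ≤ o ∧ o < 24 → m₂.Perm stk o .Cur .Freeable
  link : m₂.getN stk 8 0 = encodeVal .Mint64 (w.rs .SP)
  ra : m₂.getN stk 8 16 = encodeVal .Mint64 (w.rs .RA)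

/-- Entering the server: both sides allocate their block and store the encrypted number. -/
theorem FrameInv.init {w : CAWorld} (h : Mem.Inject w.injp.inj w.injp.src w.injp.tgt)
    (n : BitVec 32) :
    FrameInv w w.injp.src.nextblock w.injp.tgt.nextblock
      (w.injp.inj.extend w.injp.src.nextblock (w.injp.tgt.nextblock, 8))
      ((w.injp.src.alloc 0 8).1.setN w.injp.src.nextblock 0 (encodeVal .Mint32 (.Vint n)))
      (frameMem w.injp.tgt (w.rs .SP) (w.rs .RA) n) := by
  obtain ⟨⟨j, m₁, m₂⟩, sg, rs⟩ := w
  dsimp only at h ⊢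
  have hl64 : ∀ v, (encodeVal .Mint64 v).length = 8 := fun v => encodeVal_length _ _
  have hl32 : ∀ v, (encodeVal .Mint32 v).length = 4 := fun v => encodeVal_length _ _
  have huniq : ∀ b δ, j.extend m₁.nextblock (m₂.nextblock, 8) b = some (m₂.nextblock, δ) →
      b = m₁.nextblock ∧ δ = 8 := by
    intro b δ hj
    rcases MemInj.extend_cases hj with ⟨rfl, hx⟩ | ⟨_, hj⟩
    · cases hx
      exact ⟨rfl, rfl⟩
    · exact absurd (h.mappedblocks _ _ _ hj) (lt_irrefl _)
  have hreach : ∀ x, x < 8 ∨ 16 ≤ x → (j.extend m₁.nextblock (m₂.nextblock, 8)).OutOfReach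
      (m₁.alloc 0 8).1 m₂.nextblock x := by
    intro x hx b δ hj hp
    obtain ⟨rfl, rfl⟩ := huniq b δ hj
    rw [Mem.alloc_perm_new] at hp
    omega
  refine ⟨?_, ?_, le_rfl, le_rfl, MemInj.extend_self, fun b δ hj => (huniq b δ hj).1, ?_, ?_, ?_,
    ?_⟩
  · refine (InjpWorld.Acc.refl ⟨j, m₁, m₂⟩).of_sameBelow
      (MemInj.incl_extend (h.freeblocks _ (lt_irrefl _)))
      (InjpWorld.separated_extend (lt_irrefl _) (lt_irrefl _)) ?_ ?_
    · exact (Mem.SameBelow.alloc _ _ _).trans (.setN _ le_rfl _ _)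
    · exact (((Mem.SameBelow.alloc _ _ _).trans (.setN _ le_rfl _ _)).trans
        (.setN _ le_rfl _ _)).trans (.setN _ le_rfl _ _)
  · have h₁ := h.alloc (lo := 0) (hi := 8) (lo' := 0) (hi' := 24) (δ := 8) (by norm_num)
      (by norm_num) (by norm_num) (.inr (by norm_num))
    have h₂ := h₁.setN_outOfReach (b₂ := m₂.nextblock) (o := 0) (l := encodeVal .Mint64 (rs .SP))
      fun x _ hx => hreach x (by rw [hl64] at hx; omega)
    have h₃ := h₂.setN_outOfReach (b₂ := m₂.nextblock) (o := 16) (l := encodeVal .Mint64 (rs .RA))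
      fun x hx _ => hreach x (.inr hx)
    refine h₃.setN (δ := 8) (o := 0) MemInj.extend_self ((Val.Inject.int n).encodeVal .Mint32) ?_
    intro x hx hx'
    rw [hl32] at hx'
    exact Mem.alloc_perm_new.2 ⟨hx, by omega⟩
  · intro o hp
    rwa [Mem.setN_perm, Mem.alloc_perm_new] at hp
  · intro o ho
    simp only [frameMem, Mem.setN_perm, Mem.alloc_perm_new]
    omega
  · rw [frameMem, Mem.getN_setN_other _ _ _ _ _ (.inl (by norm_num)),
      Mem.getN_setN_other _ _ _ _ _ (.inl (by norm_num)), Mem.getN_setN_same _ _ _ _ (hl64 _)]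
  · rw [frameMem, Mem.getN_setN_other _ _ _ _ _ (.inr (by rw [hl32]; norm_num)),
      Mem.getN_setN_same _ _ _ _ (hl64 _)]

/-- The callback preserves the frame: its cells that hold saved registers are out of reach. -/
theorem FrameInv.call {w : CAWorld}
    (hw : Mem.Inject w.injp.inj w.injp.src w.injp.tgt) {sp stk : ℕ} {j : MemInj} {m₁ m₂ : Mem}
    (h : FrameInv w sp stk j m₁ m₂) {w' : InjpWorld} (hacc : InjpWorld.Acc ⟨j, m₁, m₂⟩ w')
    (hinj : Mem.Inject w'.inj w'.src w'.tgt) : FrameInv w sp stk w'.inj w'.src w'.tgt := by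
  have hstk : m₂.Valid stk := h.inject.mappedblocks _ _ _ h.map
  have hreach : ∀ x, x < 8 ∨ 16 ≤ x → j.OutOfReach m₁ stk x := by
    intro x hx b δ hj hp
    have := h.map_unique b δ hj
    subst this
    rw [h.map] at hj
    cases hj
    have := h.perm_src _ hp
    omega
  have hget : ∀ o, (∀ x, o ≤ x → x < o + 8 → x < 8 ∧ 0 ≤ x ∨ 16 ≤ x ∧ x < 24) →
      w'.tgt.getN stk 8 o = m₂.getN stk 8 o := by
    intro o ho
    refine Mem.getN_congr fun x hx hx' => hacc.outOfReach.contents _ _ (hreach x ?_) ?_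
    · have := ho x hx hx'
      omega
    · have := ho x hx hx'
      exact (h.perm_tgt x (by omega)).mono (by decide)
  refine ⟨h.acc.trans hw hacc, hinj, h.new_src, h.new_tgt, hacc.incr _ _ h.map, ?_, ?_, ?_, ?_, ?_⟩
  · intro b δ hj
    rcases hx : j b with _ | ⟨b', d⟩
    · exact absurd hstk (hacc.separated _ _ _ hx hj).2
    · have := hacc.incr _ _ hx
      rw [hj] at this
      cases this
      exact h.map_unique b δ hx
  · exact fun o hp => h.perm_src o (hacc.accSrc.max_perm _ _ _ (h.inject.valid_src h.map) hp)
  · exact fun o ho => (hacc.outOfReach.perm _ _ _ _ (hreach o (by omega)) hstk).1 (h.perm_tgt o ho)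
  · rw [hget 0 (by omega), h.link]
  · rw [hget 16 (by omega), h.ra]

/-- Leaving the server: both sides free their block. -/
theorem FrameInv.free {w : CAWorld} {sp stk : ℕ} {j : MemInj} {m₁ m₂ m₁' : Mem}
    (h : FrameInv w sp stk j m₁ m₂) (hf : m₁.free sp 0 8 = some m₁') :
    m₂.RangePerm stk 0 24 .Cur .Freeable ∧ ∃ m₂', m₂.free stk 0 24 = some m₂' ∧
      w.injp.Acc ⟨j, m₁', m₂'⟩ ∧ Mem.Inject j m₁' m₂' := by
  have hf₁ := Mem.free_spec hf
  have hr : m₂.RangePerm stk 0 24 .Cur .Freeable := by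
    intro x hx hx'
    by_cases hx8 : 8 ≤ x ∧ x < 16
    · simpa using h.inject.perm _ _ _ (x - 8) _ _ h.map (hf₁.range _ (by omega) (by omega))
    · exact h.perm_tgt x (by omega)
  obtain ⟨m₂', hf'⟩ := Mem.free_of_range hr
  have hf₂ := Mem.free_spec hf'
  refine ⟨hr, m₂', hf', h.acc.of_sameBelow h.acc.incr h.acc.separated
    (.of_freeSpec hf₁ h.new_src) (.of_freeSpec hf₂ h.new_tgt), h.inject.free hf₁ hf₂ ?_⟩
  intro b δ o hj _ _ hp
  have := h.map_unique b δ hj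
  subst this
  obtain ⟨hp, hn⟩ := (hf₁.perm _ _ _ _).1 hp
  exact hn ⟨rfl, h.perm_src o hp⟩

/-- The invariant between the specification and the server. -/
inductive ServerMatch (w : CAWorld) (se₁ : SymTbl) (b : ℕ) : SpecState → AsmInternal → Prop
  | calle (i : BitVec 32) (vf : Val) (hro : RoValid se₁ w.injp.src) (hpc : w.rs .PC = .Vptr b 0)
      (hi : w.rs (.IR .RDI) = .Vint i) (hvf : Val.Inject w.injp.inj vf (w.rs (.IR .RSI))) :
      ServerMatch w se₁ b (.Calle i vf w.injp.src) ⟨w.injp.tgt.nextblock, w.rs, w.injp.tgt, true⟩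
  | callp (sp stk : ℕ) (vf : Val) (j : MemInj) (m₁ m₂ : Mem) (rs : RegSet)
      (hro : RoValid se₁ m₁) (hframe : FrameInv w sp stk j m₁ m₂)
      (hpc : Val.Inject j vf (rs .PC)) (hsp : rs .SP = .Vptr stk 0) (hra : rs .RA = .Vptr b 5)
      (hdi : rs (.IR .RDI) = .Vptr stk 8) (hcs : ∀ r ∈ calleeSaveRegs, rs r = w.rs r) :
      ServerMatch w se₁ b (.Callp sp vf m₁) ⟨w.injp.tgt.nextblock, rs, m₂, true⟩
  | retp (sp stk : ℕ) (j : MemInj) (m₁ m₂ : Mem) (rs : RegSet)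
      (hframe : FrameInv w sp stk j m₁ m₂)
      (hpc : rs .PC = .Vptr b 5) (hsp : rs .SP = .Vptr stk 0)
      (hcs : ∀ r ∈ calleeSaveRegs, rs r = w.rs r) :
      ServerMatch w se₁ b (.Retp sp m₁) ⟨w.injp.tgt.nextblock, rs, m₂, true⟩
  | rete (j : MemInj) (m₁ m₂ : Mem) (rs : RegSet) (hacc : w.injp.Acc ⟨j, m₁, m₂⟩)
      (hinj : Mem.Inject j m₁ m₂) (hpc : rs .PC = w.rs .RA) (hsp : rs .SP = w.rs .SP)
      (hcs : ∀ r ∈ calleeSaveRegs, rs r = w.rs r) :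
      ServerMatch w se₁ b (.Rete m₁) ⟨w.injp.tgt.nextblock, rs, m₂, false⟩

theorem outgoingArguments_ptrVoidSg (v : Val) (b : ℕ) (o : ℤ) :
    ¬ OutgoingArguments ptrVoidSg v b o := by
  rintro ⟨so, _, h₁, h₂⟩
  have : sizeArguments ptrVoidSg = 0 := rfl
  rw [this] at h₂
  omega

/-- The specification is simulated by the server under `ro · wt · CAinjp`. -/
theorem specSem_serverOpt (encrypt key : Ident) (hne : encrypt ≠ key) :
    OpenSim (ccRo.comp (ccWt.comp ccCAinjp)) (ccRo.comp (ccWt.comp ccCAinjp))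
      (specSem encrypt key) (asmSem (serverOpt encrypt key)) := by
  refine ⟨rfl, fun w se₁ se₂ s₁ s₂ => w.2.1.2 = w.2.2.2.2.injp.src ∧
    ∃ b, ServerEntry w.2.2.2.2 (serverOpt encrypt key) se₂ b ∧
      ServerMatch w.2.2.2.2 se₁ b s₁ s₂, ?_⟩
  rintro ⟨se₁', ⟨_, m₀⟩, _, ⟨_, sg⟩, w⟩ se₁ se₂ ⟨⟨h₁, h₂⟩, ⟨h₃, h₄⟩, hse⟩ hvalid
  dsimp only at h₁ h₂ h₃ h₄ hse
  subst h₁ h₂ h₃ h₄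
  change CAWorld at w
  change w.injp.MatchSenv _ se₂ at hse
  dsimp only
  refine ⟨?_, ?_, ?_, ?_, ?_⟩
  · rintro q₁ q₂ ⟨_, ⟨rfl, _, _⟩, _, ⟨rfl, _, _⟩, hq⟩
    have hpc := hq.vf
    rw [← hq.rs] at hpc
    exact (hse.stbls.isInternal_iff _ hpc hq.vf_def).trans
      (Program.isInternal_erase (p := serverOpt encrypt key))
  · rintro q₁ q₂ s₁ ⟨_, ⟨rfl, rfl, hro⟩, _, ⟨rfl, _, _⟩, hq⟩ ⟨⟨be, i, vf, m, he⟩, hint⟩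
    obtain ⟨hsg, hrs, ⟨hm₁, hm₂, hm⟩, hvf, hargs, hor, _, hvd, hsp, hrad, hrat⟩ := hq
    obtain ⟨rs, m₂⟩ := q₂
    dsimp only at hsg hrs hm₁ hm₂ hm hvf hargs hor hvd hsp hro
    subst hrs hm₁ hm₂
    obtain ⟨be₂, hj, hs⟩ := hse.stbls.symb_some he
    have hpc : w.rs .PC = .Vptr be₂ 0 := by
      refine hvf.unique ?_ hvd ▸ rfl
      simpa using Val.Inject.ptr be be₂ 0 0 hj
    rw [← hsg] at hargs
    have hargs' : List.Forall₂ (Val.Inject w.injp.inj) [.Vint i, vf]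
        [w.rs (.IR .RDI), w.rs (.IR .RSI)] := hargs
    rw [List.forall₂_cons, List.forall₂_cons] at hargs'
    obtain ⟨hi, hv, _⟩ := hargs'
    have hi' : w.rs (.IR .RDI) = .Vint i := hi.unique (.int i) Val.noConfusion
    refine ⟨⟨_, _, _, true⟩, ⟨rfl, be₂, ⟨hm, ⟨encrypt, hs, find_serverOpt_encrypt hne⟩, hor, hsp,
      hrat⟩, .calle i vf hro hpc hi' hv⟩, ?_, ?_, hrad, rfl⟩
    · exact Program.isInternal_erase.1 ((hse.stbls.isInternal_iff _ hvf hvd).1 hint)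
    · obtain ⟨b, o, hb, _⟩ := hsp
      change w.rs .SP ≠ _
      rw [hb]
      exact Val.noConfusion
  · rintro s₁ s₂ t s₁' ⟨hm₀, b, hentry, hmatch⟩ hstep
    cases hstep with
    | encrypt i k vf m m' m'' bk sp hk hl ha hs =>
      cases hmatch with
      | calle _ _ hro hpc hi hvf =>
        cases hro.load_key hvalid hk hl
        have ha' := congrArg Prod.snd ha
        cases congrArg Prod.fst ha
        cases ha'
        obtain ⟨_, rfl⟩ := Mem.store_eq_some.1 hs
        obtain ⟨rs', hstar, hpc', hsp', hra', hdi', hcs'⟩ :=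
          star_to_call hentry.functAt w.injp.tgt.nextblock w.injp.tgt hpc hi
        have hframe := FrameInv.init (w := w) hentry.inject (i ^^^ 42)
        refine ⟨_, ⟨hm₀, b, hentry, .callp _ _ vf _ _ _ rs' (hro.of_sameBelow ?_) hframe ?_ hsp'
          hra' hdi' hcs'⟩, hstar⟩
        · exact (Mem.SameBelow.alloc _ _ _).trans (.setN _ le_rfl _ _)
        · rw [hpc']
          exact hvf.mono hframe.acc.incr
    | free sp m m' hf =>
      cases hmatch with
      | retp _ stk j _ m₂ rs hframe hpc hsp hcs =>
        obtain ⟨hr, m₂', hf₂, hacc, hinj⟩ := hframe.free hf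
        obtain ⟨bs, os, hbs, hbv⟩ := hentry.sp_valid
        obtain ⟨rs', hstar, hsp', hpc', hcs'⟩ := star_to_return hentry.functAt hpc hsp hr
          hframe.link hframe.ra (by rw [hbs]; trivial) hentry.ra_type
          (nb := w.injp.tgt.nextblock) (by simp [hbs, innerSp, show bs < _ from hbv]) hf₂
        exact ⟨_, ⟨hm₀, b, hentry, .rete j m' m₂' rs' hacc hinj hpc' hsp'
          fun r hr => (hcs' r hr).trans (hcs r hr)⟩, hstar⟩
  · rintro s₁ s₂ q₁ ⟨hm₀, b, hentry, hmatch⟩ hext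
    cases hext with
    | intro sp bp m hp =>
      cases hmatch with
      | callp _ stk _ j _ m₂ rs hro hframe hpc hsp hra hdi hcs =>
        have hse' := hse.acc hframe.acc
        have hstk : m₂.Valid stk := hframe.inject.mappedblocks _ _ _ hframe.map
        have hp₂ : (serverOpt encrypt key).IsExternal se₂ (rs .PC) :=
          Program.isExternal_erase.1 (hse'.stbls.isExternal hpc hp)
        have harg : Val.Inject j (.Vptr sp 0) (rs (.IR .RDI)) := by
          rw [hdi]
          exact Val.Inject.ptr sp stk 0 8 hframe.map
        have hrad : rs .RA ≠ .Vundef := by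
          rw [hra]
          exact Val.noConfusion
        have hrat : (rs .RA).HasType .Tptr := by
          rw [hra]
          trivial
        -- the callback happens at the current memories, with the registers at the call
        refine ⟨⟨_, ⟨_, m⟩, _, ⟨_, ptrVoidSg⟩, (⟨⟨j, m, m₂⟩, ptrVoidSg, rs⟩ : CAWorld)⟩,
          (⟨rs, m₂⟩ : AsmState), ⟨⟨rfl, rfl⟩, ⟨rfl, rfl⟩, hse'⟩,
          ⟨_, ⟨rfl, rfl, hro⟩, _, ⟨rfl, rfl, .cons trivial .nil⟩, ?_⟩, ⟨rfl, hp₂, rfl⟩, ?_⟩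
        · exact ⟨rfl, rfl, ⟨rfl, rfl, hframe.inject⟩, hpc, .cons harg .nil,
            fun b o h => absurd h (outgoingArguments_ptrVoidSg _ b o),
            fun b o h => absurd h (outgoingArguments_ptrVoidSg _ b o), Val.noConfusion,
            ⟨stk, 0, hsp, hstk⟩, hrad, hrat⟩
        · rintro ⟨v, m'⟩ ⟨rs', m₂'⟩ s₁' ⟨_, ⟨rfl, _⟩, _, ⟨rfl, _⟩, w', hr⟩ ⟨⟩
          obtain ⟨hacc, ⟨hm₁, hm₂, hinj⟩, _, _, hsp', hpc', hcs'⟩ := hr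
          dsimp only at hacc hm₁ hm₂ hinj hsp' hpc' hcs'
          subst hm₁ hm₂
          rw [hsp] at hsp'
          rw [hra] at hpc'
          refine ⟨⟨_, rs', _, true⟩, ⟨hm₀, b, hentry, .retp sp stk w'.inj _ _ rs'
            (hframe.call hentry.inject hacc hinj) hpc' hsp'
            fun r hr => (hcs' r hr).trans (hcs r hr)⟩, rfl, hp₂, true, ?_, rfl⟩
          simp [innerSp, hsp', hframe.new_tgt]
  · rintro s₁ s₂ r₁ ⟨hm₀, b, hentry, hmatch⟩ hfin
    cases hfin with
    | intro m =>
      cases hmatch with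
      | rete j _ m₂ rs hacc hinj hpc hsp hcs =>
        refine ⟨(⟨rs, m₂⟩ : AsmState), ⟨_, ⟨rfl, ?_⟩, _, ⟨rfl, trivial⟩, ⟨j, m, m₂⟩, ?_⟩, rfl, rfl⟩
        · change m₀.Acc m
          change m₀ = _ at hm₀
          rw [hm₀]
          exact hacc.accSrc
        · exact ⟨hacc, ⟨rfl, rfl, hinj⟩, .undef _, hentry.outOfReach, hsp, hpc, hcs⟩

/-! ### Composition of open simulations -/

theorem LTS.Star.trans {A B : LangInterface} {L : LTS A B} {s s' s'' : L.State} {t t' : Trace}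
    (h : L.Star s t s') (h' : L.Star s' t' s'') : L.Star s (t ++ t') s'' := by
  induction h with
  | refl => exact h'
  | step s₁ s₂ s₃ t₁ t₂ hs _ ih =>
    rw [List.append_assoc]
    exact .step _ _ _ _ _ hs (ih h')

theorem LTS.IsSimulation.star {A₁ A₂ B₁ B₂ : LangInterface} {RA : SimConv A₁ A₂}
    {RB : SimConv B₁ B₂} {se₁ se₂ : SymTbl} {w : RB.World} {L₁ : LTS A₁ B₁} {L₂ : LTS A₂ B₂}
    {R : L₁.State → L₂.State → Prop} (h : LTS.IsSimulation RA RB se₁ se₂ w L₁ L₂ R)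
    {s₁ s₁' : L₁.State} {t : Trace} (hs : L₁.Star s₁ t s₁') {s₂ : L₂.State} (hR : R s₁ s₂) :
    ∃ s₂', R s₁' s₂' ∧ L₂.Star s₂ t s₂' := by
  induction hs generalizing s₂ with
  | refl => exact ⟨s₂, hR, .refl _⟩
  | step a b c t t' hab _ ih =>
    obtain ⟨s', hR', hs'⟩ := h.step _ _ _ _ hR hab
    obtain ⟨s'', hR'', hs''⟩ := ih hR'
    exact ⟨s'', hR'', hs'.trans hs''⟩

/-- Vertical composition. The intermediate symbol table has to provide the definitions of the
module. -/
theorem OpenSim.trans {A₁ A₂ A₃ B₁ B₂ B₃ : LangInterface} {RA : SimConv A₁ A₂}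
    {RB : SimConv B₁ B₂} {SA : SimConv A₂ A₃} {SB : SimConv B₂ B₃} {L₁ : OpenSem A₁ B₁}
    {L₂ : OpenSem A₂ B₂} {L₃ : OpenSem A₃ B₃} (h : OpenSim RA RB L₁ L₂) (h' : OpenSim SA SB L₂ L₃)
    (hvalid : ∀ w se₁ se₂, RB.senv w se₁ se₂ → se₁.ValidFor L₁.skel → se₂.ValidFor L₁.skel) :
    OpenSim (RA.comp SA) (RB.comp SB) L₁ L₃ := by
  obtain ⟨hsk, R, hR⟩ := h
  obtain ⟨hsk', S, hS⟩ := h'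
  refine ⟨hsk.trans hsk', fun w se₁ se₃ s₁ s₃ =>
    ∃ s₂, R w.2.1 se₁ w.1 s₁ s₂ ∧ S w.2.2 w.1 se₃ s₂ s₃, ?_⟩
  rintro ⟨se₂, w, w'⟩ se₁ se₃ ⟨hse, hse'⟩ hv
  dsimp only at hse hse' ⊢
  have H := hR w se₁ se₂ hse hv
  have H' := hS w' se₂ se₃ hse' (hsk ▸ hvalid w se₁ se₂ hse hv)
  refine ⟨?_, ?_, ?_, ?_, ?_⟩
  · rintro q₁ q₃ ⟨q₂, hq, hq'⟩
    exact (H.valid _ _ hq).trans (H'.valid _ _ hq')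
  · rintro q₁ q₃ s₁ ⟨q₂, hq, hq'⟩ hs₁
    obtain ⟨s₂, hR₂, hs₂⟩ := H.initial _ _ _ hq hs₁
    obtain ⟨s₃, hR₃, hs₃⟩ := H'.initial _ _ _ hq' hs₂
    exact ⟨s₃, ⟨s₂, hR₂, hR₃⟩, hs₃⟩
  · rintro s₁ s₃ t s₁' ⟨s₂, hR₂, hR₃⟩ hs
    obtain ⟨s₂', hR₂', hs₂⟩ := H.step _ _ _ _ hR₂ hs
    obtain ⟨s₃', hR₃', hs₃⟩ := H'.star hs₂ hR₃
    exact ⟨s₃', ⟨s₂', hR₂', hR₃'⟩, hs₃⟩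
  · rintro s₁ s₃ q₁ ⟨s₂, hR₂, hR₃⟩ hq
    obtain ⟨wA, q₂, hw, hq₂, hx₂, hk⟩ := H.external _ _ _ hR₂ hq
    obtain ⟨wA', q₃, hw', hq₃, hx₃, hk'⟩ := H'.external _ _ _ hR₃ hx₂
    refine ⟨(se₂, wA, wA'), q₃, ⟨hw, hw'⟩, ⟨q₂, hq₂, hq₃⟩, hx₃, ?_⟩
    rintro r₁ r₃ s₁' ⟨r₂, hr, hr'⟩ ha
    obtain ⟨s₂', hR₂', ha₂⟩ := hk _ _ _ hr ha
    obtain ⟨s₃', hR₃', ha₃⟩ := hk' _ _ _ hr' ha₂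
    exact ⟨s₃', ⟨s₂', hR₂', hR₃'⟩, ha₃⟩
  · rintro s₁ s₃ r₁ ⟨s₂, hR₂, hR₃⟩ hf
    obtain ⟨r₂, hr, hf₂⟩ := H.final _ _ _ hR₂ hf
    obtain ⟨r₃, hr', hf₃⟩ := H'.final _ _ _ hR₃ hf₂
    exact ⟨r₃, ⟨r₂, hr, hr'⟩, hf₃⟩

/-- `R` refines `S`: every world of `S` has a counterpart in `R` that relates at least the same
symbol tables and queries, and at most the same replies. -/
def SimConv.Refines {A B : LangInterface} (R S : SimConv A B) : Prop :=
  ∀ w, ∃ w', (∀ se₁ se₂, S.senv w se₁ se₂ → R.senv w' se₁ se₂) ∧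
    (∀ q₁ q₂, S.query w q₁ q₂ → R.query w' q₁ q₂) ∧
    ∀ r₁ r₂, R.reply w' r₁ r₂ → S.reply w r₁ r₂

theorem OpenSim.of_refines {A₁ A₂ B₁ B₂ : LangInterface} {RA SA : SimConv A₁ A₂}
    {RB SB : SimConv B₁ B₂} {L₁ : OpenSem A₁ B₁} {L₂ : OpenSem A₂ B₂} (h : OpenSim RA RB L₁ L₂)
    (hA : SA.Refines RA) (hB : RB.Refines SB) : OpenSim SA SB L₁ L₂ := by
  obtain ⟨hsk, R, hR⟩ := h
  choose f hf using hB
  refine ⟨hsk, fun w => R (f w), fun w se₁ se₂ hse hv => ?_⟩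
  obtain ⟨hs, hq, hr⟩ := hf w
  have H := hR (f w) se₁ se₂ (hs _ _ hse) hv
  refine ⟨fun q₁ q₂ h => H.valid _ _ (hq _ _ h), fun q₁ q₂ s₁ h => H.initial _ _ _ (hq _ _ h),
    H.step, ?_, ?_⟩
  · intro s₁ s₂ q₁ hR hx
    obtain ⟨wA, q₂, hw, hq₂, hx₂, hk⟩ := H.external _ _ _ hR hx
    obtain ⟨wA', hs', hq', hr'⟩ := hA wA
    exact ⟨wA', q₂, hs' _ _ hw, hq' _ _ hq₂, hx₂, fun r₁ r₂ s₁' h => hk _ _ _ (hr' _ _ h)⟩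
  · intro s₁ s₂ r₁ hR hfin
    obtain ⟨r₂, h, hfin₂⟩ := H.final _ _ _ hR hfin
    exact ⟨r₂, hr _ _ h, hfin₂⟩

/-- Regrouping a fourfold composition of conventions to the right only permutes the components of
its worlds. -/
theorem SimConv.comp₄_refines_left {A B C D E : LangInterface} (R : SimConv A B) (S : SimConv B C)
    (T : SimConv C D) (U : SimConv D E) :
    ((R.comp (S.comp T)).comp U).Refines (R.comp (S.comp (T.comp U))) := by
  rintro ⟨se₁, w₁, se₂, w₂, se₃, w₃, w₄⟩
  refine ⟨⟨se₃, ⟨se₁, w₁, se₂, w₂, w₃⟩, w₄⟩, ?_, ?_, ?_⟩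
  · rintro _ _ ⟨h₁, h₂, h₃, h₄⟩
    exact ⟨⟨h₁, h₂, h₃⟩, h₄⟩
  · rintro _ _ ⟨q₁, h₁, q₂, h₂, q₃, h₃, h₄⟩
    exact ⟨q₃, ⟨q₁, h₁, q₂, h₂, h₃⟩, h₄⟩
  · rintro _ _ ⟨r₃, ⟨r₁, h₁, r₂, h₂, h₃⟩, h₄⟩
    exact ⟨r₁, h₁, r₂, h₂, r₃, h₃, h₄⟩

theorem SimConv.comp₄_refines_right {A B C D E : LangInterface} (R : SimConv A B)
    (S : SimConv B C) (T : SimConv C D) (U : SimConv D E) :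
    (R.comp (S.comp (T.comp U))).Refines ((R.comp (S.comp T)).comp U) := by
  rintro ⟨se₃, ⟨se₁, w₁, se₂, w₂, w₃⟩, w₄⟩
  refine ⟨⟨se₁, w₁, se₂, w₂, se₃, w₃, w₄⟩, ?_, ?_, ?_⟩
  · rintro _ _ ⟨⟨h₁, h₂, h₃⟩, h₄⟩
    exact ⟨h₁, h₂, h₃, h₄⟩
  · rintro _ _ ⟨q₃, ⟨q₁, h₁, q₂, h₂, h₃⟩, h₄⟩
    exact ⟨q₁, h₁, q₂, h₂, q₃, h₃, h₄⟩
  · rintro _ _ ⟨r₁, h₁, r₂, h₂, r₃, h₃, h₄⟩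
    exact ⟨r₃, ⟨r₁, h₁, r₂, h₂, h₃⟩, h₄⟩

end CompCertO

theorem mainTheorem7 (encrypt key : CompCertO.Ident) (hne : encrypt ≠ key) :
    CompCertO.OpenSim CompCertO.ccDirect CompCertO.ccDirect
      (CompCertO.specSem encrypt key) (CompCertO.asmSem (CompCertO.serverOpt encrypt key)) := by
  refine ((CompCertO.specSem_serverOpt encrypt key hne).trans (CompCertO.asmSem_self _)
    ?_).of_refines (CompCertO.SimConv.comp₄_refines_right _ _ _ _)
    (CompCertO.SimConv.comp₄_refines_left _ _ _ _)
  rintro ⟨_, ⟨_, _⟩, _, ⟨_, _⟩, _⟩ se₁ se₂ ⟨⟨h₁, h₂⟩, ⟨h₃, h₄⟩, hse⟩ hv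
  dsimp only at h₁ h₂ h₃ h₄ hse
  subst h₁ h₂ h₃ h₄
  exact hse.stbls.validFor hv
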